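/- Let $H\in\mathbb C^{n\times n}$ be symmetric and $z\in\mathbb C$ such that all leading principal submatrices of $A:=H-zI$ are invertible, and let $A=LDL^T$ be the factorization with $L$ unit lower triangular and $D$ diagonal. Let $G(H)$ be the graph on $\{1,\dots,n\}$ with an edge between $i\ne j$ iff $H(i,j)\neq0$. A *fill path* between $i$ and $j$ is a path in $G(H)$ whose interior vertices are all smaller than $\min\{i,j\}$; $d_{\rm fill}(i,j)\in\mathbb N\cup\{\infty\}$ is the minimal number of edges of such a path, and $\mathrm{level}(i,j)=\max\{0,d_{\rm fill}(i,j)-1\}$. For an integer cut-off $c\ge1$ let $$\mathrm{ifnz}=\{(i,j): (L(i,j)\ne0\text{ or }L(j,i)\neq 0)\text{ and }\mathrm{level}(i,j)\le c\},\qquad \tilde r(j)=\{i>j:(i,j)\in\mathrm{ifnz}\},\qquad \ell=\{1,\dots,j-1\}.$$ *Incomplete factorization:* for $j=1,\dots,n$ set $\tilde D(j,j)=A(j,j)-\tilde L(j,\ell)\tilde D(\ell,\ell)\tilde L^T(\ell,j)$ and $\tilde L(\tilde r,j)=\big(A(\tilde r,j)-\tilde L(\tilde r,\ell)\tilde D(\ell,\ell)\tilde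 L^T(\ell,j)\big)/\tilde D(j,j)$. *Incomplete selected inversion:* for $j=n,\dots,1$ set $B(\tilde r,j)=-B(\tilde r,\tilde r)\tilde L(\tilde r,j)$, $B(j,\tilde r)=B(\tilde r,j)^T$ and $B(j,j)=\tilde D(j,j)^{-1}-B(j,\tilde r)\tilde L(\tilde r,j)$. Unspecified entries are zero. Both are run as sparse algorithms, with $\mathrm{ifnz}$ given as index lists, on a random access machine on which reading a matrix entry, writing one, and one arithmetic operation on complex numbers take unit time; memory is the number of stored matrix entries (nonzeros of $A$, outputs and work space) and indices. *Effective dimension $d$* (with constants $\rho\in\mathbb N$, $R\in\mathbb R$, $\kappa>0$): the vertices of $G(H)$ have positions in a box in $\mathbb R^d$ with all sides of length at least $1$, such that every cube of unit side contains at most $\rho$ vertices, the positions of adjacent vertices differ by at most $R$ in each coordinate, and $n\ge\kappa\cdot(\text{volume of the box})$. *Nested dissection order* (with constants $w\in\mathbb R$, $\theta\in(0,1/2]$): the order $1,\dots,n$ of the vertices in the box arises by recursively partitioning the vertices of a box (unless there are none) into $V_1,V_2,V_{\rm sep}$ without edges between $V_1$ and $V_2$ and listing them as $V_1,V_2,V_{\rm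 sep}$, with $V_1,V_2$ ordered recursively and $V_{\rm sep}$ ordered arbitrarily. Here $V_{\rm sep}$ lies within distance $w$ of an axis-perpendicular hyperplane which cuts the box into two boxes containing $V_1$ and $V_2$, each retaining at least the fraction $\theta$ of the side that is cut, and this side is at least $\theta$ times as long as every side of the box. **Theorem.** Let the problem have effective dimension $d\in\{2,3\}$ and be given in a nested dissection order. Then there is a constant $C$, depending only on $\rho,R,\kappa,w,\theta$ (and $d$), such that for all $n$, all $c\ge1$ and all such $H,z$, incomplete factorization and incomplete selected inversion together require * if $d=2$: at most $C\,nc$ runtime and, for $c\ge2$, at most $C\,n\log c$ memory; * if $d=3$: at most $C\,nc^3$ runtime and at most $C\,nc$ memory. In particular, the bounds are linear in $n$ for fixed $c$. -/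

import Mathlib

/-! ### Graph of a matrix, fill paths, level of fill -/

/-- The graph of a symmetric matrix: distinct `i`, `j` are adjacent iff the `(i, j)` entry is
nonzero.  (Self-loops never occur on a shortest path, so diagonal entries are left out.) -/
def matrixGraph {n : ℕ} (H : Matrix (Fin n) (Fin n) ℂ) : SimpleGraph (Fin n) :=
  SimpleGraph.fromRel fun i j => H i j ≠ 0

/-- A fill path: a path all of whose interior vertices are numbered lower than both ends. -/
def IsFillPath {n : ℕ} {G : SimpleGraph (Fin n)} {i j : Fin n} (p : G.Walk i j) : Prop :=
  p.IsPath ∧ ∀ k ∈ p.support, k = i ∨ k = j ∨ k < min i j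

/-- Minimal number of edges on a fill path between `i` and `j` (`⊤` if there is none). -/
noncomputable def fillDist {n : ℕ} (G : SimpleGraph (Fin n)) (i j : Fin n) : ℕ∞ :=
  ⨅ (p : G.Walk i j) (_ : IsFillPath p), (p.length : ℕ∞)

/-- `level(i,j) = max {0, d_fill(i,j) - 1}` (subtraction in `ℕ∞` truncates, `⊤ - 1 = ⊤`). -/
noncomputable def fillLevel {n : ℕ} (G : SimpleGraph (Fin n)) (i j : Fin n) : ℕ∞ :=
  fillDist G i j - 1

/-! ### The exact factorization and the restricted sparsity pattern -/

/-- All leading principal submatrices are invertible. -/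
def LeadingMinorsInvertible {n : ℕ} (A : Matrix (Fin n) (Fin n) ℂ) : Prop :=
  ∀ (m : ℕ) (hm : m ≤ n), IsUnit (A.submatrix (Fin.castLE hm) (Fin.castLE hm))

/-- `A = L D Lᵀ` with `L` lower triangular with unit diagonal and `D` diagonal. -/
structure IsLDLT {n : ℕ} (A L : Matrix (Fin n) (Fin n) ℂ) (D : Fin n → ℂ) : Prop where
  unit_diag : ∀ i, L i i = 1
  lower : ∀ i j, i < j → L i j = 0
  factor : A = L * Matrix.diagonal D * L.transpose

/-- `(i, j) ∈ ifnz(H)`: the entry is nonzero in the exact factor `L` (or its transpose) and its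
level of fill in the graph of `H` is at most `c`. -/
def IFNZ {n : ℕ} (H L : Matrix (Fin n) (Fin n) ℂ) (c : ℕ) (i j : Fin n) : Prop :=
  (L i j ≠ 0 ∨ L j i ≠ 0) ∧ fillLevel (matrixGraph H) i j ≤ (c : ℕ∞)

/-! ### Effective dimension and nested dissection -/

/-- The graph `G` on `n` vertices has effective dimension `d`: its vertices (orbitals, mesh points)
sit at positions `pos` in a `d`-dimensional box `[lo, hi]` such that at most `ρ` vertices lie in a
cube of unit side, interacting vertices are at most `R` apart in each coordinate, and the box,
all of whose sides are at least the unit length, holds at least `κ` vertices per unit volume on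
average.  Positions need not be distinct. -/
structure HasEffectiveDimension {n : ℕ} (d : ℕ) (G : SimpleGraph (Fin n)) (ρ : ℕ) (R κ : ℝ)
    (pos : Fin n → Fin d → ℝ) (lo hi : Fin d → ℝ) : Prop where
  mem_box : ∀ v k, lo k ≤ pos v k ∧ pos v k ≤ hi k
  one_le_side : ∀ k, 1 ≤ hi k - lo k
  density_le : ∀ p : Fin d → ℝ, {v | ∀ k, p k ≤ pos v k ∧ pos v k ≤ p k + 1}.ncard ≤ ρ
  range_le : ∀ u v, G.Adj u v → ∀ k, |pos u k - pos v k| ≤ R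
  le_density : κ * ∏ k, (hi k - lo k) ≤ n

/-- `NestedDissection G pos w θ lo hi l`: the list `l` enumerates the vertices of a cluster located
in the box `[lo, hi]` in a nested dissection order.  The cluster is empty, or it is partitioned into
`V₁`, `V₂`, `Vsep` without edges between `V₁` and `V₂` and listed as `V₁, V₂, Vsep`, where `V₁` and
`V₂` are ordered recursively and the order in `Vsep` is arbitrary.  The separator is a slice: it lies
within distance `w` of a hyperplane `x a = t` which cuts the box into two boxes containing `V₁` and
`V₂`.  The cut is balanced: `a` is a longest direction of the box up to the factor `θ`, and either
part keeps at least the fraction `θ` of the side that is cut. -/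
inductive NestedDissection {n d : ℕ} (G : SimpleGraph (Fin n)) (pos : Fin n → Fin d → ℝ)
    (w θ : ℝ) : (Fin d → ℝ) → (Fin d → ℝ) → List (Fin n) → Prop
  | nil (lo hi : Fin d → ℝ) : NestedDissection G pos w θ lo hi []
  | node (lo hi : Fin d → ℝ) (a : Fin d) (t : ℝ) (V₁ V₂ Vsep : List (Fin n))
      (long : ∀ k, θ * (hi k - lo k) ≤ hi a - lo a)
      (balanced : lo a + θ * (hi a - lo a) ≤ t ∧ t ≤ hi a - θ * (hi a - lo a))
      (separated : ∀ u ∈ V₁, ∀ v ∈ V₂, ¬ G.Adj u v)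
      (slice : ∀ v ∈ Vsep, (∀ k, lo k ≤ pos v k ∧ pos v k ≤ hi k) ∧ |pos v a - t| ≤ w)
      (left : NestedDissection G pos w θ lo (Function.update hi a t) V₁)
      (right : NestedDissection G pos w θ (Function.update lo a t) hi V₂) :
      NestedDissection G pos w θ lo hi (V₁ ++ V₂ ++ Vsep)

/-! ### A random access machine over the complex numbers

Memory cells are the entries of sparse arrays; a cell that was never written holds zero and takes no
memory.  Reading a cell, writing a cell and one arithmetic operation take one unit of time each. -/

inductive Cell (n : ℕ) : Type
  | A (i j : Fin n)
  | D (j : Fin n)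
  | L (i j : Fin n)
  | B (i j : Fin n)
  | W (i : Fin n)
  deriving DecidableEq

structure Machine (n : ℕ) : Type where
  /-- contents of the cells -/
  val : Cell n → ℂ
  /-- cells that are allocated -/
  used : Finset (Cell n)
  /-- elapsed time -/
  time : ℕ

abbrev Prog (n : ℕ) (α : Type) : Type := StateM (Machine n) α

def load {n : ℕ} (x : Cell n) : Prog n ℂ := fun M =>
  (M.val x, { M with time := M.time + 1 })

def store {n : ℕ} (x : Cell n) (v : ℂ) : Prog n Unit := fun M =>
  ((), { val := Function.update M.val x v, used := insert x M.used, time := M.time + 1 })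

/-- One arithmetic operation, whose result is `v`. -/
def flop {n : ℕ} (v : ℂ) : Prog n ℂ := fun M =>
  (v, { M with time := M.time + 1 })

open Classical in
/-- The rows `i > j` with `(i, j)` in the pattern `P`, i.e. the index set `r̃(j)`. -/
noncomputable def colIdx {n : ℕ} (P : Fin n → Fin n → Prop) (j : Fin n) : List (Fin n) :=
  (List.finRange n).filter fun i => j < i ∧ P i j

open Classical in
/-- The columns `k < j` with `(j, k)` in the pattern `P`. -/
noncomputable def rowIdx {n : ℕ} (P : Fin n → Fin n → Prop) (j : Fin n) : List (Fin n) :=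
  (List.finRange n).filter fun k => k < j ∧ P j k

/-- Iteration `j` of the incomplete `LDLᵀ` factorization.  With `r̃ = colIdx P j`, the work array
receives `A(i,j) - L(i,ℓ) D(ℓ,ℓ) Lᵀ(ℓ,j)` for `i = j` and `i ∈ r̃`; then `D(j,j)` is set to its
`j`-th entry and `L(i,j)` to its `i`-th entry divided by `D(j,j)`, for `i ∈ r̃`.  The product runs
through the stored entries of each column `k < j` with `L(j,k)` stored; what it adds to work cells
outside `{j} ∪ r̃` is dropped, as these cells are not read before they are overwritten with an entry
of `A`. -/
noncomputable def factorColumn {n : ℕ} (P : Fin n → Fin n → Prop) (j : Fin n) : Prog n Unit := do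
  let a ← load (Cell.A j j)
  store (Cell.W j) a
  (colIdx P j).forM fun i => do
    let a ← load (Cell.A i j)
    store (Cell.W i) a
  (rowIdx P j).forM fun k => do
    let l ← load (Cell.L j k)
    let d ← load (Cell.D k)
    let m ← flop (d * l)
    (colIdx P k).forM fun i => do
      let x ← load (Cell.L i k)
      let y ← flop (x * m)
      let s ← load (Cell.W i)
      let s' ← flop (s - y)
      store (Cell.W i) s'
  let d ← load (Cell.W j)
  store (Cell.D j) d
  (colIdx P j).forM fun i => do
    let s ← load (Cell.W i)
    let q ← flop (s / d)
    store (Cell.L i j) q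

/-- Iteration `j` of the incomplete selected inversion: `B(r̃,j) = -B(r̃,r̃) L(r̃,j)`, then
`B(j,r̃) = B(r̃,j)ᵀ`, then `B(j,j) = D(j,j)⁻¹ - B(j,r̃) L(r̃,j)`. -/
noncomputable def invertColumn {n : ℕ} (P : Fin n → Fin n → Prop) (j : Fin n) : Prog n Unit := do
  (colIdx P j).forM fun i => do
    store (Cell.B i j) 0
    (colIdx P j).forM fun k => do
      let b ← load (Cell.B i k)
      let l ← load (Cell.L k j)
      let p ← flop (b * l)
      let s ← load (Cell.B i j)
      let s' ← flop (s - p)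
      store (Cell.B i j) s'
  (colIdx P j).forM fun i => do
    let b ← load (Cell.B i j)
    store (Cell.B j i) b
  let d ← load (Cell.D j)
  let e ← flop (1 / d)
  store (Cell.B j j) e
  (colIdx P j).forM fun i => do
    let b ← load (Cell.B j i)
    let l ← load (Cell.L i j)
    let p ← flop (b * l)
    let s ← load (Cell.B j j)
    let s' ← flop (s - p)
    store (Cell.B j j) s'

/-- Incomplete `LDLᵀ` factorization: `j` runs from the first to the last column. -/
noncomputable def incompleteFactorization {n : ℕ} (P : Fin n → Fin n → Prop) : Prog n Unit :=
  (List.finRange n).forM (factorColumn P)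

/-- Incomplete selected inversion: `j` runs from the last to the first column. -/
noncomputable def incompleteSelectedInversion {n : ℕ} (P : Fin n → Fin n → Prop) : Prog n Unit :=
  (List.finRange n).reverse.forM (invertColumn P)

open Classical in
/-- The machine at the start: the nonzero entries of `A` are stored. -/
noncomputable def initialMachine {n : ℕ} (A : Matrix (Fin n) (Fin n) ℂ) : Machine n where
  val x := match x with
    | Cell.A i j => A i j
    | _ => 0
  used := ((Finset.univ : Finset (Fin n × Fin n)).filter fun p => A p.1 p.2 ≠ 0).image
    fun p => Cell.A p.1 p.2
  time := 0

/-- The machine after incomplete factorization followed by incomplete selected inversion of `A`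
on the pattern `P`. -/
noncomputable def finalMachine {n : ℕ} (P : Fin n → Fin n → Prop)
    (A : Matrix (Fin n) (Fin n) ℂ) : Machine n :=
  ((incompleteFactorization P >>= fun _ => incompleteSelectedInversion P).run
    (initialMachine A)).2

/-- Total running time of both algorithms. -/
noncomputable def runtime {n : ℕ} (P : Fin n → Fin n → Prop)
    (A : Matrix (Fin n) (Fin n) ℂ) : ℕ :=
  (finalMachine P A).time

/-- Total memory of both algorithms: all allocated cells (input, output and work space; cells are
never freed) and the stored index lists with two pointers per column. -/
noncomputable def memory {n : ℕ} (P : Fin n → Fin n → Prop)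
    (A : Matrix (Fin n) (Fin n) ℂ) : ℕ :=
  (finalMachine P A).used.card + ∑ j, ((colIdx P j).length + (rowIdx P j).length + 2)

/-! Both costs reduce to column counts. With r(j) the set of stored rows below the diagonal of
column j, the runtime is O(n + Σ |r(j)|²) (`runtime_le`) and the memory is O(n + Σ |r(j)|) plus the
nonzeros of A (`memory_le`); the latter number O(n) because edges have bounded range.

The column counts are geometric. Each vertex j lies in the separator of exactly one box of the
dissection tree. Vertices outside the cluster of that box, but adjacent to it, come later in the
order, so a walk from j whose interior does not exceed j can leave the cluster only with its last
step. Its end i > j is thus in the separator or near a face of the box: in one of 2d + 1 slabs of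
bounded thickness. It is also within distance O(c) of j. If the side that is cut has length s ≥ θ,
this gives |r(j)| = O(min(s,c)^(d-1)) (`card_fillReachable_le`). The separator has O(vol/s) vertices
(`length_separator_le`), so it contributes O(vol · min(s,c)^p / s) to Σ |r(j)|^e, where p = (d-1)e.
If s < θ, then |r(j)| = O(1), and all such boxes together contribute O(n).

Boxes of one generation have at most the volume of the root in total, and s shrinks geometrically,
so the sum should behave like that of min(s,c)^p / s over geometric scales s: scales near c dominate
and give c^(p-1) if p ≥ 2, while for p = 1 all scales between 1 and c count equally and give log c.
As boxes of one generation differ in size, the summation is done by a potential vol · Σ F(side),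
with F modelled on an antiderivative of min(s,c)^p / s² (`boxPotential_cut`,
`NestedDissection.sum_card_pow_le`). Its value at the root is at most (n/κ) · d · sup F. Runtime
needs p = 2 and 4 for d = 2 and 3, memory p = 1 and 2. -/

/-! ### Counting vertices in boxes -/

section Counting

variable {n d : ℕ} {pos : Fin n → Fin d → ℝ} {ρ : ℕ}

/-- Rounding down the coordinates relative to `p` sorts the vertices into unit cubes with at most
`ρ` vertices each. -/
theorem card_le_of_mem_box
    (hρ : ∀ p : Fin d → ℝ, {v | ∀ k, p k ≤ pos v k ∧ pos v k ≤ p k + 1}.ncard ≤ ρ)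
    (S : Finset (Fin n)) (p ℓ : Fin d → ℝ) (hℓ : ∀ k, 0 ≤ ℓ k)
    (hS : ∀ v ∈ S, ∀ k, p k ≤ pos v k ∧ pos v k ≤ p k + ℓ k) :
    (S.card : ℝ) ≤ ρ * ∏ k, (ℓ k + 1) := by
  classical
  have key : S.card ≤ ρ * (Fintype.piFinset fun k => Finset.range (⌊ℓ k⌋₊ + 1)).card := by
    refine Finset.card_le_mul_card_image_of_maps_to (f := fun v k => ⌊pos v k - p k⌋₊) ?_ ρ ?_
    · intro v hv
      simp only [Fintype.mem_piFinset, Finset.mem_range]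
      intro k
      exact Nat.lt_succ_of_le (Nat.floor_le_floor (by linarith [(hS v hv k).2]))
    · intro b _
      refine le_trans ?_ (hρ fun k => p k + b k)
      rw [← Set.ncard_coe_finset]
      refine Set.ncard_le_ncard ?_ (Set.toFinite _)
      intro v hv
      simp only [Finset.coe_filter, Set.mem_ofPred_eq] at hv
      intro k
      have h0 : 0 ≤ pos v k - p k := by linarith [(hS v hv.1 k).1]
      have hb : ⌊pos v k - p k⌋₊ = b k := congrFun hv.2 k
      have h1 := Nat.floor_le h0
      have h2 := Nat.lt_floor_add_one (pos v k - p k)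
      rw [hb] at h1 h2
      constructor <;> linarith
  have h2 : (S.card : ℝ) ≤ ρ * ∏ k, ((⌊ℓ k⌋₊ : ℝ) + 1) := by
    rw [Fintype.card_piFinset] at key
    simp only [Finset.card_range] at key
    exact_mod_cast key
  refine h2.trans ?_
  gcongr with k
  exact Nat.floor_le (hℓ k)

theorem card_le_of_mem_slab
    (hρ : ∀ p : Fin d → ℝ, {v | ∀ k, p k ≤ pos v k ∧ pos v k ≤ p k + 1}.ncard ≤ ρ)
    (S : Finset (Fin n)) (p ℓ : Fin d → ℝ) (hℓ : ∀ k, 0 ≤ ℓ k)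
    (a : Fin d) (τ W : ℝ) (hW : 0 ≤ W)
    (hS : ∀ v ∈ S, |pos v a - τ| ≤ W ∧ ∀ k, p k ≤ pos v k ∧ pos v k ≤ p k + ℓ k) :
    (S.card : ℝ) ≤ ρ * ((2 * W + 1) * ∏ k ∈ Finset.univ.erase a, (ℓ k + 1)) := by
  classical
  have := card_le_of_mem_box hρ S (Function.update p a (τ - W)) (Function.update ℓ a (2 * W)) ?_ ?_
  · rw [← Finset.mul_prod_erase _ _ (Finset.mem_univ a)] at this
    simp only [Function.update_self] at this
    refine this.trans_eq ?_
    congr 2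
    refine Finset.prod_congr rfl fun k hk => ?_
    rw [Function.update_of_ne (Finset.ne_of_mem_erase hk)]
  · intro k
    rcases eq_or_ne k a with rfl | h
    · simpa using hW
    · simpa [h] using hℓ k
  · intro v hv k
    rcases eq_or_ne k a with rfl | h
    · have := abs_le.1 (hS v hv).1
      simp only [Function.update_self]
      constructor <;> linarith
    · simpa [h] using (hS v hv).2 k

end Counting

/-! ### Potentials on the side lengths of the boxes -/

/-- `F` is a nonnegative monotone potential that drops by at least a fixed multiple of
`min s c ^ p / s` whenever a side `s ≥ θ` is shortened by the factor `1 - θ`. -/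
structure IsSidePotential (θ : ℝ) (c : ℝ) (p : ℕ) (η : ℝ) (F : ℝ → ℝ) : Prop where
  nonneg : ∀ s, 0 < s → 0 ≤ F s
  mono : ∀ s s', 0 < s' → s' ≤ s → F s' ≤ F s
  drop : ∀ s s', θ ≤ s → 0 < s' → s' ≤ (1 - θ) * s → F s' + η * (min s c ^ p / s) ≤ F s

/-- The potential is `s ^ (p + 1)` up to `c` and `2 * c ^ (p + 1) - c ^ (p + 2) / s` beyond, which
imitates an antiderivative of `min s c ^ (p + 2) / s ^ 2`. Taking `x = 0` gives monotonicity, `x =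
θ` the drop. -/
theorem powPotential_le {c s x : ℝ} (p : ℕ) (hc : 0 < c) (hs : 0 < s) (hx0 : 0 ≤ x)
    {s' : ℝ} (hs'0 : 0 < s') (hs' : s' ≤ (1 - x) * s) :
    (2 * min s' c ^ (p + 1) - min s' c ^ (p + 2) / s') + x * (min s c ^ (p + 2) / s)
      ≤ 2 * min s c ^ (p + 1) - min s c ^ (p + 2) / s := by
  have hss : s' ≤ s := hs'.trans (by nlinarith)
  rcases le_total s c with h | h
  · rw [min_eq_left h, min_eq_left (hss.trans h)]
    have e1 : ∀ t : ℝ, 0 < t → t ^ (p + 2) / t = t ^ (p + 1) := fun t ht => by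
      rw [pow_succ]; field_simp
    rw [e1 _ hs, e1 _ hs'0]
    have : s' ^ (p + 1) ≤ s ^ p * ((1 - x) * s) := by
      rw [pow_succ]; gcongr
    have e2 : s ^ (p + 1) = s ^ p * s := pow_succ _ _
    nlinarith
  · rw [min_eq_right h]
    have hcs : x * (c ^ (p + 2) / s) + c ^ (p + 2) / s = (1 + x) * (c ^ (p + 2) / s) := by ring
    rcases le_total s' c with h' | h'
    · rw [min_eq_left h']
      have e1 : s' ^ (p + 2) / s' = s' ^ (p + 1) := by rw [pow_succ]; field_simp
      rw [e1]
      have hA : s' ^ (p + 1) ≤ c ^ p * s' := by rw [pow_succ]; gcongr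
      have hB : c ^ p * s' + (1 + x) * (c ^ (p + 2) / s) ≤ 2 * c ^ (p + 1) := by
        have : (1 + x) * (c ^ (p + 2) / s) = c ^ p * ((1 + x) * c ^ 2 / s) := by ring
        rw [this, ← mul_add]
        have : (1 + x) * c ^ 2 / s ≤ 2 * c - s' := by
          rw [div_le_iff₀ hs]
          -- If `c ≤ (1 - x) * s`, then `s' ≤ c` is the sharper bound on `s'`; otherwise `s' ≤ (1 -
          -- x) * s` is.
          have h3 : s' * s ≤ 2 * c * s - (1 + x) * c ^ 2 := by
            rcases le_total c ((1 - x) * s) with h4 | h4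
            · have : s' * s ≤ c * s := by gcongr
              nlinarith [mul_nonneg hx0 hx0, mul_le_mul_of_nonneg_left h4 hc.le,
                mul_nonneg (mul_nonneg hx0 hx0) (mul_nonneg hc.le hs.le)]
            · have h5 : s' * s ≤ (1 - x) * s * s := by gcongr
              have h6 : 0 ≤ (s - c) * (c - (1 - x) * s) :=
                mul_nonneg (by linarith) (by linarith)
              nlinarith [mul_nonneg hx0 (mul_nonneg hc.le (sub_nonneg.2 h))]
          linarith
        calc c ^ p * (s' + (1 + x) * c ^ 2 / s) ≤ c ^ p * (2 * c) := by gcongr; linarith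
          _ = 2 * c ^ (p + 1) := by ring
      linarith
    · rw [min_eq_right h']
      have : (1 + x) * (c ^ (p + 2) / s) ≤ c ^ (p + 2) / s' := by
        rw [← mul_div_assoc, div_le_div_iff₀ hs hs'0]
        have : (1 + x) * s' ≤ s := by nlinarith [mul_nonneg hx0 (mul_nonneg hx0 hs.le)]
        calc (1 + x) * c ^ (p + 2) * s' = c ^ (p + 2) * ((1 + x) * s') := by ring
          _ ≤ _ := by gcongr
      linarith

theorem min_pow_div_le {c s : ℝ} (p : ℕ) (hc : 0 < c) (hs : 0 < s) :
    min s c ^ (p + 1) / s ≤ min s c ^ p := by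
  have hm : 0 < min s c := lt_min hs hc
  rw [div_le_iff₀ hs, pow_succ]
  exact mul_le_mul_of_nonneg_left (min_le_left _ _) (by positivity)

theorem isSidePotential_pow {θ c : ℝ} (p : ℕ) (hc : 0 < c) (hθ : 0 < θ) :
    IsSidePotential θ c (p + 2) θ fun s => 2 * min s c ^ (p + 1) - min s c ^ (p + 2) / s where
  nonneg s hs := by
    have := min_pow_div_le (p + 1) hc hs
    have : 0 ≤ min s c ^ (p + 1) := by have := lt_min hs hc; positivity
    linarith
  mono s s' hs' h := by
    have := powPotential_le p hc (hs'.trans_le h) le_rfl hs' (by simpa using h)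
    linarith
  drop s s' hs hs' h := powPotential_le p hc (hθ.trans_le hs) hθ.le hs' h

theorem powPotential_le_bound {c s : ℝ} (p : ℕ) (hc : 0 < c) (hs : 0 < s) :
    2 * min s c ^ (p + 1) - min s c ^ (p + 2) / s ≤ 2 * c ^ (p + 1) := by
  have hm : 0 < min s c := lt_min hs hc
  have h1 : min s c ^ (p + 1) ≤ c ^ (p + 1) := by gcongr; exact min_le_right _ _
  have h2 : 0 ≤ min s c ^ (p + 2) / s := by positivity
  linarith

theorem logPotential_mono {c s s' : ℝ} (hc : 0 < c) (hs' : 0 < s') (h : s' ≤ s) :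
    Real.log (1 + min s' c) + 1 - min s' c / s' ≤ Real.log (1 + min s c) + 1 - min s c / s := by
  have hs := hs'.trans_le h
  have h1 : Real.log (1 + min s' c) ≤ Real.log (1 + min s c) := by
    have := lt_min hs' hc
    gcongr
  have h2 : min s c / s ≤ min s' c / s' := by
    rw [div_le_div_iff₀ hs hs']
    rcases le_total s' c with h3 | h3
    · rw [min_eq_left h3, mul_comm]
      gcongr; exact min_le_left _ _
    · rw [min_eq_right h3, min_eq_right (h3.trans h)]
      gcongr
  linarith

/-- In the borderline case `p = 1` the antiderivative is logarithmic up to `c`. The shift to `log (1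
+ s)` keeps it nonnegative; for `s ≤ c` the drop is then at least `θ * s / (1 + s)`, which `s ≥ θ`
bounds below by `θ ^ 2 / 2`. -/
theorem isSidePotential_log {θ c : ℝ} (hc : 1 ≤ c) (hθ : 0 < θ) (hθ' : θ ≤ 1 / 2) :
    IsSidePotential θ c 1 (θ ^ 2 / 2) fun s => Real.log (1 + min s c) + 1 - min s c / s where
  nonneg s hs := by
    have hm : 0 < min s c := lt_min hs (by linarith)
    have h1 : 0 ≤ Real.log (1 + min s c) := Real.log_nonneg (by linarith)
    have h2 : min s c / s ≤ 1 := (div_le_one hs).2 (min_le_left _ _)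
    linarith
  mono s s' hs' h := logPotential_mono (by linarith) hs' h
  drop s s' hs hs' h := by
    have hc0 : 0 < c := by linarith
    have hs0 : 0 < s := hθ.trans_le hs
    have hu0 : 0 < (1 - θ) * s := by nlinarith
    -- By monotonicity only the extreme case `s' = (1 - θ) * s` is left.
    refine (add_le_add_left (logPotential_mono hc0 hs' h) _).trans ?_
    set u := (1 - θ) * s with hu
    have hus : u ≤ s := by nlinarith
    rw [pow_one]
    rcases le_total s c with h1 | h1
    · rw [min_eq_left h1, min_eq_left (hus.trans h1), div_self hs0.ne', div_self hu0.ne']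
      have h2 : Real.log ((1 + u) / (1 + s)) ≤ (1 + u) / (1 + s) - 1 :=
        Real.log_le_sub_one_of_pos (by positivity)
      rw [Real.log_div (by positivity) (by positivity)] at h2
      have h3 : (1 + u) / (1 + s) - 1 ≤ - (θ ^ 2 / 2) := by
        rw [div_sub_one (by positivity), div_le_iff₀ (by positivity), hu]
        nlinarith [mul_le_mul_of_nonneg_left hs hθ.le, mul_pos hθ hs0]
      linarith
    · rw [min_eq_right h1]
      rcases le_total u c with h2 | h2
      · rw [min_eq_left h2, div_self hu0.ne']
        have h3 : Real.log ((1 + u) / (1 + c)) ≤ (1 + u) / (1 + c) - 1 :=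
          Real.log_le_sub_one_of_pos (by positivity)
        rw [Real.log_div (by positivity) (by positivity)] at h3
        -- Here `c ≥ 1` enters: `1 + c ≤ 2 * c`, and `u - c` is not positive.
        have h4 : (1 + u) / (1 + c) - 1 ≤ (u - c) / (2 * c) := by
          rw [div_sub_one (by positivity), div_le_div_iff₀ (by positivity) (by positivity)]
          nlinarith
        have h5 : (1 + θ ^ 2 / 2) * (c / s) + (u - c) / (2 * c) ≤ 1 := by
          rw [mul_div_assoc', div_add_div _ _ hs0.ne' (by positivity), div_le_one (by positivity)]
          have hθ2 : θ ^ 2 ≤ θ / 2 := by nlinarith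
          have h7 : 0 ≤ (s - c) * (c - u) := mul_nonneg (by linarith) (by linarith)
          have h8 : s * u = (1 - θ) * s ^ 2 := by rw [hu]; ring
          rw [hu] at h7 h2
          nlinarith [mul_nonneg hθ.le (mul_nonneg hc0.le (sub_nonneg.2 h1)), mul_pos hθ (mul_pos hs0 hc0), mul_pos hc0 hc0, mul_pos hs0 hc0]
        nlinarith
      · rw [min_eq_right h2]
        have : (1 + θ ^ 2 / 2) * (c / s) ≤ c / u := by
          rw [mul_div_assoc', div_le_div_iff₀ hs0 hu0]
          have : (1 + θ ^ 2 / 2) * u ≤ s := by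
            rw [hu]
            have : (1 + θ ^ 2 / 2) * (1 - θ) ≤ 1 := by nlinarith [pow_pos hθ 3]
            nlinarith
          nlinarith
        linarith

theorem logPotential_le_bound {c s : ℝ} (hc : 0 < c) (hs : 0 < s) :
    Real.log (1 + min s c) + 1 - min s c / s ≤ Real.log (1 + c) + 1 := by
  have hm : 0 < min s c := lt_min hs hc
  have h1 : Real.log (1 + min s c) ≤ Real.log (1 + c) := by gcongr; exact min_le_right _ _
  have h2 : 0 ≤ min s c / s := by positivity
  linarith

/-! ### Fill neighbours in a nested dissection order -/

section Dissection

variable {n d : ℕ} {G : SimpleGraph (Fin n)} {pos : Fin n → Fin d → ℝ} {w θ W : ℝ}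

/-- `i > j` is reached from `j` by a walk of length at most `m` whose interior vertices do not
exceed `j`. -/
def FillReachable (G : SimpleGraph (Fin n)) (m : ℕ) (j i : Fin n) : Prop :=
  j < i ∧ ∃ p : G.Walk j i, (∀ k ∈ p.support, k = i ∨ k ≤ j) ∧ p.length ≤ m

theorem abs_pos_sub_le_of_walk (hW : ∀ u v, G.Adj u v → ∀ k, |pos u k - pos v k| ≤ W)
    {j i : Fin n} (p : G.Walk j i) (k : Fin d) : |pos i k - pos j k| ≤ W * p.length := by
  induction p with
  | nil => simp
  | @cons u v x h p ih =>
    have h1 := hW u v h k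
    have h2 := abs_sub_le (pos x k) (pos v k) (pos u k)
    rw [abs_sub_comm (pos v k)] at h2
    rw [SimpleGraph.Walk.length_cons]
    push_cast
    linarith

/-- A walk that leaves a cluster only towards vertices greater than `j` ends in the cluster or one
step outside of it. -/
theorem mem_or_adj_of_walk {l : List (Fin n)} {j : Fin n}
    (outer : ∀ u ∉ l, ∀ v ∈ l, G.Adj v u → j < u) {x i : Fin n} (p : G.Walk x i) (hx : x ∈ l)
    (hp : ∀ k ∈ p.support, k = i ∨ k ≤ j) : i ∈ l ∨ (i ∉ l ∧ ∃ v ∈ l, G.Adj v i) := by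
  induction p with
  | nil => exact Or.inl hx
  | @cons u v y h p ih =>
    by_cases hv : v ∈ l
    · exact ih hv fun k hk => hp k (by simp [hk])
    · have h1 := outer v hv u hx h
      rcases hp v (by simp) with h2 | h2
      · subst h2
        exact Or.inr ⟨hv, u, hx, h⟩
      · exact absurd h1 (not_lt.2 h2)

/-- The sides of the box `[lo, hi]` are positive, and no side is shorter than a unit as well as
much shorter than another side. -/
def WellShaped (θ : ℝ) (lo hi : Fin d → ℝ) : Prop :=
  ∀ k, 0 < hi k - lo k ∧ ∀ k', min 1 (θ ^ 2 * (hi k' - lo k')) ≤ hi k - lo k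

/-- Neighbours of the cluster `l` outside of it come later in the order and are close to a
face of the box. -/
def OuterNear (G : SimpleGraph (Fin n)) (pos : Fin n → Fin d → ℝ) (W : ℝ) (lo hi : Fin d → ℝ)
    (l : List (Fin n)) : Prop :=
  ∀ u ∉ l, ∀ v ∈ l, G.Adj v u →
    (∀ x ∈ l, x < u) ∧ ∃ k, |pos u k - lo k| ≤ W ∨ |pos u k - hi k| ≤ W

/-- The cut side was longest up to the factor `θ` and keeps the fraction `θ`, so it remains at least
`θ ^ 2` times every side. The other sides are unchanged and are compared with sides that did not
grow. -/
theorem WellShaped.of_cut {lo hi lo' hi' : Fin d → ℝ} (h : WellShaped θ lo hi) (hθ : 0 < θ)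
    {a : Fin d} (long : ∀ k, θ * (hi k - lo k) ≤ hi a - lo a)
    (hne : ∀ k, k ≠ a → hi' k - lo' k = hi k - lo k)
    (hlow : θ * (hi a - lo a) ≤ hi' a - lo' a) (hup : hi' a - lo' a ≤ hi a - lo a) :
    WellShaped θ lo' hi' := by
  have hle : ∀ k, hi' k - lo' k ≤ hi k - lo k := fun k => by
    rcases eq_or_ne k a with rfl | hk
    · exact hup
    · exact (hne k hk).le
  intro k
  rcases eq_or_ne k a with rfl | hk
  · refine ⟨(mul_pos hθ (h k).1).trans_le hlow, fun k' => (min_le_right _ _).trans ?_⟩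
    calc θ ^ 2 * (hi' k' - lo' k') ≤ θ ^ 2 * (hi k' - lo k') :=
        mul_le_mul_of_nonneg_left (hle k') (sq_nonneg θ)
      _ = θ * (θ * (hi k' - lo k')) := by ring
      _ ≤ θ * (hi k - lo k) := by gcongr; exact long k'
      _ ≤ _ := hlow
  · rw [hne k hk]
    refine ⟨(h k).1, fun k' => le_trans ?_ ((h k).2 k')⟩
    exact min_le_min_left _ (mul_le_mul_of_nonneg_left (hle k') (sq_nonneg θ))

theorem cut_pos {lo hi : Fin d → ℝ} {a : Fin d} {t : ℝ} (hpos : ∀ k, 0 < hi k - lo k)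
    (hθ : 0 < θ) (balanced : lo a + θ * (hi a - lo a) ≤ t ∧ t ≤ hi a - θ * (hi a - lo a)) :
    lo a < t ∧ t < hi a := by
  have := mul_pos hθ (hpos a)
  constructor <;> linarith

theorem NestedDissection.mem_box {lo hi : Fin d → ℝ} {l : List (Fin n)}
    (h : NestedDissection G pos w θ lo hi l) (hθ : 0 < θ) (hpos : ∀ k, 0 < hi k - lo k) :
    ∀ v ∈ l, ∀ k, lo k ≤ pos v k ∧ pos v k ≤ hi k := by
  induction h with
  | nil => simp
  | node lo hi a t V₁ V₂ Vsep long balanced separated slice left right ihl ihr =>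
    obtain ⟨h1, h2⟩ := cut_pos hpos hθ balanced
    have ihl := ihl fun k => by
      rcases eq_or_ne k a with rfl | hk
      · simpa using h1
      · simpa [hk] using hpos k
    have ihr := ihr fun k => by
      rcases eq_or_ne k a with rfl | hk
      · simpa using h2
      · simpa [hk] using hpos k
    intro v hv k
    simp only [List.mem_append] at hv
    rcases hv with (hv | hv) | hv
    · refine ⟨(ihl v hv k).1, (ihl v hv k).2.trans ?_⟩
      rcases eq_or_ne k a with rfl | hk
      · simpa using h2.le
      · simp [hk]
    · refine ⟨le_trans ?_ (ihr v hv k).1, (ihr v hv k).2⟩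
      rcases eq_or_ne k a with rfl | hk
      · simpa using h1.le
      · simp [hk]
    · exact (slice v hv).1 k

/-! ### One dissection step: inheritance by the two parts, and counts around the separator -/

section Node

variable {lo hi : Fin d → ℝ} {a : Fin d} {t : ℝ} {V₁ V₂ Vsep : List (Fin n)}

/-- An outside neighbour of `V₁` cannot be in `V₂`. In `Vsep` it is later and close to the new face
`t`; outside the parent cluster it is close to a face of the parent, of which only `hi a` has moved.
-/
theorem OuterNear.left (outer : OuterNear G pos W lo hi (V₁ ++ V₂ ++ Vsep))
    (sorted : (V₁ ++ V₂ ++ Vsep).Pairwise (· < ·))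
    (hW : ∀ u v, G.Adj u v → ∀ k, |pos u k - pos v k| ≤ W) (ht : t < hi a)
    (separated : ∀ u ∈ V₁, ∀ v ∈ V₂, ¬ G.Adj u v)
    (slice : ∀ v ∈ Vsep, |pos v a - t| ≤ W)
    (hbox : ∀ v ∈ V₁, pos v a ≤ t) :
    OuterNear G pos W lo (Function.update hi a t) V₁ := by
  intro u hu v hv huv
  by_cases hu' : u ∈ V₁ ++ V₂ ++ Vsep
  · simp only [List.mem_append, hu, false_or] at hu'
    rcases hu' with hu' | hu'
    · exact absurd huv (separated v hv u hu')
    · refine ⟨fun x hx => (List.pairwise_append.1 sorted).2.2 x (by simp [hx]) u hu', a, Or.inr ?_⟩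
      simpa using slice u hu'
  · obtain ⟨h1, k, hk⟩ := outer u hu' v (by simp [hv]) huv
    refine ⟨fun x hx => h1 x (by simp [hx]), k, ?_⟩
    rcases eq_or_ne k a with rfl | hka
    · rcases hk with hk | hk
      · exact Or.inl hk
      · refine Or.inr ?_
        have h2 := abs_le.1 (hW v u huv k)
        have h3 := hbox v hv
        have h4 := abs_le.1 hk
        simp only [Function.update_self]
        rw [abs_le]
        constructor <;> linarith
    · simpa [hka] using hk

theorem OuterNear.right (outer : OuterNear G pos W lo hi (V₁ ++ V₂ ++ Vsep))
    (sorted : (V₁ ++ V₂ ++ Vsep).Pairwise (· < ·))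
    (hW : ∀ u v, G.Adj u v → ∀ k, |pos u k - pos v k| ≤ W) (ht : lo a < t)
    (separated : ∀ u ∈ V₁, ∀ v ∈ V₂, ¬ G.Adj u v)
    (slice : ∀ v ∈ Vsep, |pos v a - t| ≤ W)
    (hbox : ∀ v ∈ V₂, t ≤ pos v a) :
    OuterNear G pos W (Function.update lo a t) hi V₂ := by
  intro u hu v hv huv
  by_cases hu' : u ∈ V₁ ++ V₂ ++ Vsep
  · simp only [List.mem_append, hu, or_false] at hu'
    rcases hu' with hu' | hu'
    · exact absurd huv.symm (separated u hu' v hv)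
    · refine ⟨fun x hx => (List.pairwise_append.1 sorted).2.2 x (by simp [hx]) u hu', a, Or.inl ?_⟩
      simpa using slice u hu'
  · obtain ⟨h1, k, hk⟩ := outer u hu' v (by simp [hv]) huv
    refine ⟨fun x hx => h1 x (by simp [hx]), k, ?_⟩
    rcases eq_or_ne k a with rfl | hka
    · rcases hk with hk | hk
      · refine Or.inl ?_
        have h2 := abs_le.1 (hW v u huv k)
        have h3 := hbox v hv
        have h4 := abs_le.1 hk
        simp only [Function.update_self]
        rw [abs_le]
        constructor <;> linarith
      · exact Or.inr hk
    · simpa [hka] using hk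

/-- Fill neighbours of a vertex of the separator are close to the cutting hyperplane or to a face
of the box. -/
theorem FillReachable.near (outer : OuterNear G pos W lo hi (V₁ ++ V₂ ++ Vsep))
    (sorted : (V₁ ++ V₂ ++ Vsep).Pairwise (· < ·))
    (hW : ∀ u v, G.Adj u v → ∀ k, |pos u k - pos v k| ≤ W) (hW0 : 0 ≤ W)
    (slice : ∀ v ∈ Vsep, |pos v a - t| ≤ W)
    (hbox : ∀ v ∈ V₁ ++ V₂ ++ Vsep, ∀ k, lo k ≤ pos v k ∧ pos v k ≤ hi k)
    {m : ℕ} {j i : Fin n} (hj : j ∈ Vsep) (h : FillReachable G m j i) :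
    (∀ k, |pos i k - pos j k| ≤ W * m) ∧ (∀ k, lo k - W ≤ pos i k ∧ pos i k ≤ hi k + W) ∧
      (|pos i a - t| ≤ W ∨ ∃ k, |pos i k - lo k| ≤ W ∨ |pos i k - hi k| ≤ W) := by
  obtain ⟨hji, p, hp, hlen⟩ := h
  have hjl : j ∈ V₁ ++ V₂ ++ Vsep := by simp [hj]
  refine ⟨fun k => (abs_pos_sub_le_of_walk hW p k).trans (by gcongr), ?_⟩
  rcases mem_or_adj_of_walk (j := j) (fun u hu v hv huv => (outer u hu v hv huv).1 j hjl) p hjl hp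
    with hi' | ⟨hi', v, hv, hvi⟩
  · refine ⟨fun k => ⟨by linarith [(hbox i hi' k).1], by linarith [(hbox i hi' k).2]⟩, Or.inl ?_⟩
    -- All of `V₁` and `V₂` precedes `j`, so an end `i > j` inside the cluster is in `Vsep`.
    rcases List.mem_append.1 hi' with h1 | h1
    · exact absurd ((List.pairwise_append.1 sorted).2.2 i h1 j hj) (not_lt.2 hji.le)
    · exact slice i h1
  · refine ⟨fun k => ?_, Or.inr (outer i hi' v hv hvi).2⟩
    have h1 := abs_le.1 (hW v i hvi k)
    have h2 := hbox v hv k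
    constructor <;> linarith

variable {ρ : ℕ}

/-- A set of vertices close to the cutting hyperplane or to the faces of the box, and
contained in a cube with side `ℓ`. -/
theorem card_le_of_near
    (hρ : ∀ p : Fin d → ℝ, {v | ∀ k, p k ≤ pos v k ∧ pos v k ≤ p k + 1}.ncard ≤ ρ)
    (hW0 : 0 ≤ W) (S : Finset (Fin n))
    (hS : ∀ i ∈ S, |pos i a - t| ≤ W ∨ ∃ k, |pos i k - lo k| ≤ W ∨ |pos i k - hi k| ≤ W)
    (p : Fin d → ℝ) {ℓ : ℝ} (hℓ : 0 ≤ ℓ) (hp : ∀ i ∈ S, ∀ k, p k ≤ pos i k ∧ pos i k ≤ p k + ℓ) :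
    (S.card : ℝ) ≤ (2 * d + 1) * (ρ * ((2 * W + 1) * (ℓ + 1) ^ (d - 1))) := by
  classical
  have slab : ∀ b τ, ((S.filter fun i => |pos i b - τ| ≤ W).card : ℝ)
      ≤ ρ * ((2 * W + 1) * (ℓ + 1) ^ (d - 1)) := fun b τ => by
    have := card_le_of_mem_slab hρ (S.filter fun i => |pos i b - τ| ≤ W) p (fun _ => ℓ)
      (fun _ => hℓ) b τ W hW0 fun v hv => by
        rw [Finset.mem_filter] at hv
        exact ⟨hv.2, hp v hv.1⟩
    simpa [Finset.card_erase_of_mem] using this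
  -- One slab around the cut and two for each of the `d` axes: `2 * d + 1` in all.
  have hsub : S ⊆ (S.filter fun i => |pos i a - t| ≤ W) ∪
      Finset.univ.biUnion fun k => (S.filter fun i => |pos i k - lo k| ≤ W) ∪
        S.filter fun i => |pos i k - hi k| ≤ W := by
    intro i hi
    have := hS i hi
    simp only [Finset.mem_union, Finset.mem_filter, hi, true_and, Finset.mem_biUnion,
      Finset.mem_univ]
    exact this
  have h1 : (S.card : ℝ) ≤ (S.filter fun i => |pos i a - t| ≤ W).card +
      ∑ k, (((S.filter fun i => |pos i k - lo k| ≤ W).card : ℝ) +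
        (S.filter fun i => |pos i k - hi k| ≤ W).card) := by
    have := (Finset.card_le_card hsub).trans ((Finset.card_union_le _ _).trans
      (Nat.add_le_add_left (Finset.card_biUnion_le.trans
        (Finset.sum_le_sum fun k _ => Finset.card_union_le _ _)) _))
    exact_mod_cast this
  have h2 := Finset.sum_le_sum fun k (_ : k ∈ (Finset.univ : Finset (Fin d))) =>
    add_le_add (slab k (lo k)) (slab k (hi k))
  rw [Finset.sum_const, Finset.card_univ, Fintype.card_fin, nsmul_eq_mul] at h2
  nlinarith [slab a t]

/-- The number of fill neighbours of a vertex of the separator. -/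
theorem card_fillReachable_le
    (hρ : ∀ p : Fin d → ℝ, {v | ∀ k, p k ≤ pos v k ∧ pos v k ≤ p k + 1}.ncard ≤ ρ)
    (outer : OuterNear G pos W lo hi (V₁ ++ V₂ ++ Vsep))
    (sorted : (V₁ ++ V₂ ++ Vsep).Pairwise (· < ·))
    (hW : ∀ u v, G.Adj u v → ∀ k, |pos u k - pos v k| ≤ W) (hW1 : 1 ≤ W)
    (slice : ∀ v ∈ Vsep, |pos v a - t| ≤ W)
    (hbox : ∀ v ∈ V₁ ++ V₂ ++ Vsep, ∀ k, lo k ≤ pos v k ∧ pos v k ≤ hi k)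
    (hθ : 0 < θ) (hθ' : θ ≤ 1) (hpos : ∀ k, 0 < hi k - lo k)
    (long : ∀ k, θ * (hi k - lo k) ≤ hi a - lo a)
    {c : ℕ} (hc : 1 ≤ c) {j : Fin n} (hj : j ∈ Vsep) (S : Finset (Fin n))
    (hS : ∀ i ∈ S, FillReachable G (c + 1) j i) :
    (S.card : ℝ) ≤ (2 * d + 1) * (ρ * ((2 * W + 1) *
      (5 * W / θ * max 1 (min ((hi a - lo a) / θ) c)) ^ (d - 1))) := by
  have hW0 : 0 ≤ W := by linarith
  have near := fun i hi' => (hS i hi').near outer sorted hW hW0 slice hbox hj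
  have hc' : (1 : ℝ) ≤ c := by exact_mod_cast hc
  have hsa := hpos a
  have hside : ∀ k, hi k - lo k ≤ (hi a - lo a) / θ := fun k => by
    rw [le_div_iff₀ hθ]; linarith [long k]
  -- Two cubes contain the fill neighbours: one around the box enlarged by `W`, and one around `j`
  -- whose radius is the reach of `c + 1` steps.
  have h1 := card_le_of_near hρ hW0 S (fun i hi' => (near i hi').2.2) (fun k => lo k - W)
    (ℓ := (hi a - lo a) / θ + 2 * W) (by positivity) fun i hi' k => by
      have := (near i hi').2.1 k
      have := hside k
      constructor <;> linarith
  have h2 := card_le_of_near hρ hW0 S (fun i hi' => (near i hi').2.2) (fun k => pos j k - W * (c + 1))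
    (ℓ := 2 * (W * (c + 1))) (by positivity) fun i hi' k => by
      have := abs_le.1 ((near i hi').1 k)
      push_cast at this
      constructor <;> linarith
  have hWθ : W ≤ W / θ := by rw [le_div_iff₀ hθ]; nlinarith
  -- The cube selected by the minimum is used. The factor 5 absorbs `2 * W + 1` and `2 * W * (c + 1)
  -- + 1`, as `W` and `c` are at least 1; `max 1` covers boxes shorter than `θ`.
  rcases min_choice ((hi a - lo a) / θ) (c : ℝ) with h | h
  · refine h1.trans ?_
    rw [h]
    gcongr
    set x := (hi a - lo a) / θ
    have h3 : x ≤ max 1 x := le_max_right _ _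
    have h4 : 1 ≤ max 1 x := le_max_left _ _
    have e : 5 * W / θ * max 1 x = 5 * (W / θ * max 1 x) := by ring
    have h5 : W * max 1 x ≤ W / θ * max 1 x := by gcongr
    rw [e]
    nlinarith
  · refine h2.trans ?_
    rw [h, max_eq_right hc']
    gcongr
    have e : 5 * W / θ * c = 5 * (W / θ * c) := by ring
    have h5 : W * c ≤ W / θ * c := by gcongr
    rw [e]
    nlinarith

/-- A slab count gives the product of `side + 1` over the directions other than `a`. Sides of length
at least `δ` satisfy `side + 1 ≤ (1 + 1 / δ) * side`, so this is comparable to the cross-section,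
volume over cut side. -/
theorem length_separator_le
    (hρ : ∀ p : Fin d → ℝ, {v | ∀ k, p k ≤ pos v k ∧ pos v k ≤ p k + 1}.ncard ≤ ρ)
    (sorted : Vsep.Nodup) (hW0 : 0 ≤ W)
    (slice : ∀ v ∈ Vsep, (∀ k, lo k ≤ pos v k ∧ pos v k ≤ hi k) ∧ |pos v a - t| ≤ W)
    {δ : ℝ} (hδ : 0 < δ) (hside : ∀ k, δ ≤ hi k - lo k) :
    (Vsep.length : ℝ) ≤ ρ * ((2 * W + 1) * ((1 + 1 / δ) ^ (d - 1) *
      ((∏ k, (hi k - lo k)) / (hi a - lo a)))) := by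
  classical
  have h := card_le_of_mem_slab hρ Vsep.toFinset lo (fun k => hi k - lo k)
    (fun k => hδ.le.trans (hside k)) a t W hW0 fun v hv => by
      obtain ⟨h1, h2⟩ := slice v (List.mem_toFinset.1 hv)
      exact ⟨h2, fun k => by simpa using h1 k⟩
  rw [List.toFinset_card_of_nodup sorted] at h
  refine h.trans ?_
  gcongr
  rw [← Finset.mul_prod_erase _ _ (Finset.mem_univ a),
    mul_div_cancel_left₀ _ (hδ.trans_le (hside a)).ne']
  have : (1 + 1 / δ) ^ (d - 1) = ∏ k ∈ Finset.univ.erase a, (1 + 1 / δ) := by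
    simp [Finset.card_erase_of_mem]
  rw [this, ← Finset.prod_mul_distrib]
  refine Finset.prod_le_prod (fun k _ => ?_) fun k _ => ?_
  · linarith [hside k]
  · have h1 := hside k
    have : 1 ≤ 1 / δ * (hi k - lo k) := by rw [one_div, inv_mul_eq_div, le_div_iff₀ hδ]; linarith
    linarith

end Node

end Dissection

/-! ### Summation over the dissection tree -/

section Summation

variable {n d : ℕ} {G : SimpleGraph (Fin n)} {pos : Fin n → Fin d → ℝ} {w θ W : ℝ}

/-- The potential of a box with sides `σ`. -/
noncomputable def boxPotential (F : ℝ → ℝ) (σ : Fin d → ℝ) : ℝ :=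
  (∏ k, σ k) * ∑ k, F (σ k)

/-- The volumes of the parts add up to that of the box, so the terms of the uncut directions are
preserved. In direction `a` a volume-weighted mean of `F x` and `F x'` replaces `F (σ a)`, and both
are lower by at least `y`. -/
theorem boxPotential_cut {F : ℝ → ℝ} {σ : Fin d → ℝ} (hσ : ∀ k, 0 < σ k) {a : Fin d} {x x' y : ℝ}
    (hx : 0 < x) (hx' : 0 < x') (hsum : x + x' = σ a)
    (h : F x + y ≤ F (σ a)) (h' : F x' + y ≤ F (σ a)) :
    boxPotential F (Function.update σ a x) + boxPotential F (Function.update σ a x')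
      + (∏ k, σ k) * y ≤ boxPotential F σ := by
  classical
  have hP : 0 < ∏ k ∈ Finset.univ.erase a, σ k := Finset.prod_pos fun k _ => hσ k
  have e1 : ∀ z, ∏ k ∈ Finset.univ.erase a, Function.update σ a z k
      = ∏ k ∈ Finset.univ.erase a, σ k := fun z => Finset.prod_congr rfl fun k hk => by
    rw [Function.update_of_ne (Finset.ne_of_mem_erase hk)]
  have e2 : ∀ z, ∑ k ∈ Finset.univ.erase a, F (Function.update σ a z k)
      = ∑ k ∈ Finset.univ.erase a, F (σ k) := fun z => Finset.sum_congr rfl fun k hk => by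
    rw [Function.update_of_ne (Finset.ne_of_mem_erase hk)]
  simp only [boxPotential, ← Finset.mul_prod_erase _ _ (Finset.mem_univ a),
    ← Finset.add_sum_erase _ _ (Finset.mem_univ a), e1, e2, Function.update_self]
  rw [← hsum] at h h' ⊢
  have h1 := mul_le_mul_of_nonneg_left h (mul_pos hx hP).le
  have h2 := mul_le_mul_of_nonneg_left h' (mul_pos hx' hP).le
  linarith

theorem sum_map_le_length_mul (l : List (Fin n)) (f : Fin n → ℝ) (b : ℝ) (h : ∀ x ∈ l, f x ≤ b) :
    (l.map f).sum ≤ l.length * b := by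
  have := List.sum_le_card_nsmul (l.map f) b (by simpa using h)
  simpa using this

/-- The cost of the fill neighbourhoods of the separator of one cluster is paid for by its number of
vertices if the box is small, and by the drop of the potential otherwise. -/
theorem separator_cost_le (d ρ e : ℕ) {θ W : ℝ} (hθ : 0 < θ) (hθ' : θ ≤ 1) (hW1 : 1 ≤ W) :
    ∃ K : ℝ, 0 ≤ K ∧ ∀ (n c : ℕ) (G : SimpleGraph (Fin n)) (pos : Fin n → Fin d → ℝ)
      (lo hi : Fin d → ℝ) (a : Fin d) (t : ℝ) (V₁ V₂ Vsep : List (Fin n))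
      (S : Fin n → Finset (Fin n)),
      (∀ p : Fin d → ℝ, {v | ∀ k, p k ≤ pos v k ∧ pos v k ≤ p k + 1}.ncard ≤ ρ) →
      (∀ u v, G.Adj u v → ∀ k, |pos u k - pos v k| ≤ W) → 1 ≤ c →
      (∀ j, ∀ i ∈ S j, FillReachable G (c + 1) j i) →
      OuterNear G pos W lo hi (V₁ ++ V₂ ++ Vsep) →
      (V₁ ++ V₂ ++ Vsep).Pairwise (· < ·) →
      (∀ v ∈ Vsep, (∀ k, lo k ≤ pos v k ∧ pos v k ≤ hi k) ∧ |pos v a - t| ≤ W) →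
      (∀ v ∈ V₁ ++ V₂ ++ Vsep, ∀ k, lo k ≤ pos v k ∧ pos v k ≤ hi k) →
      WellShaped θ lo hi → (∀ k, θ * (hi k - lo k) ≤ hi a - lo a) →
      (hi a - lo a < θ ∧ (Vsep.map fun j => ((S j).card : ℝ) ^ e).sum ≤ K * Vsep.length) ∨
      (θ ≤ hi a - lo a ∧ (Vsep.map fun j => ((S j).card : ℝ) ^ e).sum ≤ K *
        ((∏ k, (hi k - lo k)) * (min (hi a - lo a) c ^ ((d - 1) * e) / (hi a - lo a)))) := by
  have hW0 : 0 ≤ W := by linarith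
  -- `K₀` belongs to a single neighbourhood, `K₁` to the size of the separator, `K₂` to the `e`-th
  -- power of a neighbourhood in a large box.
  set K₀ : ℝ := (2 * d + 1) * (ρ * ((2 * W + 1) * (5 * W / θ) ^ (d - 1))) with hK₀
  have hK₀0 : 0 ≤ K₀ := by positivity
  set K₁ : ℝ := ρ * ((2 * W + 1) * (1 + 1 / θ ^ 3) ^ (d - 1)) with hK₁
  have hK₁0 : 0 ≤ K₁ := by positivity
  set K₂ : ℝ := (K₀ / θ ^ (d - 1)) ^ e with hK₂
  have hK₂0 : 0 ≤ K₂ := by positivity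
  refine ⟨K₀ ^ e + K₁ * K₂, by positivity, ?_⟩
  intro n c G pos lo hi a t V₁ V₂ Vsep S hρ hW hc hS outer sorted slice hbox shape long
  have hsa := (shape a).1
  have hcard : ∀ j ∈ Vsep, ((S j).card : ℝ) ≤
      K₀ * max 1 (min ((hi a - lo a) / θ) c) ^ (d - 1) := fun j hj => by
    refine (card_fillReachable_le hρ outer sorted hW hW1 (fun v hv => (slice v hv).2) hbox hθ hθ'
      (fun k => (shape k).1) long hc hj (S j) (hS j)).trans_eq ?_
    rw [hK₀, mul_pow]
    ring
  rcases lt_or_ge (hi a - lo a) θ with h | h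
  · refine Or.inl ⟨h, ?_⟩
    refine (sum_map_le_length_mul Vsep _ (K₀ ^ e) fun j hj => ?_).trans ?_
    · have h1 := hcard j hj
      have h2 : (hi a - lo a) / θ ≤ 1 := (div_le_one hθ).2 h.le
      rw [max_eq_left ((min_le_left _ _).trans h2), one_pow, mul_one] at h1
      gcongr
    · rw [mul_comm]
      gcongr
      have := mul_nonneg hK₁0 hK₂0
      linarith
  · refine Or.inr ⟨h, ?_⟩
    have hc' : (1 : ℝ) ≤ c := by exact_mod_cast hc
    set m := min (hi a - lo a) (c : ℝ) with hm
    have hm0 : 0 < m := lt_min hsa (by linarith)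
    refine (sum_map_le_length_mul Vsep _ (K₂ * m ^ ((d - 1) * e)) fun j hj => ?_).trans ?_
    · have h1 := hcard j hj
      have h2 : 1 ≤ (hi a - lo a) / θ := (one_le_div hθ).2 h
      rw [max_eq_right (le_min h2 hc')] at h1
      have h3 : min ((hi a - lo a) / θ) c ≤ m / θ := by
        rw [hm, ← min_div_div_right hθ.le]
        gcongr
        rw [le_div_iff₀ hθ]
        nlinarith
      have h4 : ((S j).card : ℝ) ≤ K₀ / θ ^ (d - 1) * m ^ (d - 1) := by
        refine h1.trans ?_
        calc K₀ * min ((hi a - lo a) / θ) c ^ (d - 1) ≤ K₀ * (m / θ) ^ (d - 1) := by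
              have := lt_min (div_pos hsa hθ) (zero_lt_one.trans_le hc')
              gcongr
          _ = _ := by rw [div_pow]; ring
      calc ((S j).card : ℝ) ^ e ≤ (K₀ / θ ^ (d - 1) * m ^ (d - 1)) ^ e := by gcongr
        _ = _ := by rw [mul_pow, ← pow_mul]
    -- The shape condition compares with the cut side, which is at least `θ`: every side is at least
    -- `min 1 (θ ^ 2 * θ)`.
    · have hδ : ∀ k, θ ^ 3 ≤ hi k - lo k := fun k => by
        refine le_trans (le_min ?_ ?_) ((shape k).2 a)
        · exact pow_le_one₀ hθ.le hθ'
        · rw [pow_succ]; gcongr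
      have hlen := length_separator_le hρ
        ((List.pairwise_append.1 sorted).2.1.imp fun h => h.ne) hW0 slice
        (pow_pos hθ 3) hδ
      have hvol : 0 < ∏ k, (hi k - lo k) := Finset.prod_pos fun k _ => (shape k).1
      have e1 : ρ * ((2 * W + 1) * ((1 + 1 / θ ^ 3) ^ (d - 1) *
          ((∏ k, (hi k - lo k)) / (hi a - lo a))))
          = K₁ * ((∏ k, (hi k - lo k)) / (hi a - lo a)) := by rw [hK₁]; ring
      rw [e1] at hlen
      calc Vsep.length * (K₂ * m ^ ((d - 1) * e))
          ≤ K₁ * ((∏ k, (hi k - lo k)) / (hi a - lo a)) * (K₂ * m ^ ((d - 1) * e)) := by gcongr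
        _ = (K₁ * K₂) * ((∏ k, (hi k - lo k)) * (m ^ ((d - 1) * e) / (hi a - lo a))) := by ring
        _ ≤ _ := by
          gcongr
          have := pow_nonneg hK₀0 e
          linarith

/-- Induction over the dissection tree. Small boxes are charged to the vertices of their separators,
large ones to the drop of the potential. `K` is chosen before `c` and `F`, so `c` enters only
through the potential. -/
theorem NestedDissection.sum_card_pow_le (d ρ e : ℕ) {θ W η : ℝ} (hθ : 0 < θ) (hθ' : θ ≤ 1)
    (hW1 : 1 ≤ W) (hη : 0 < η) :
    ∃ K : ℝ, 0 ≤ K ∧ ∀ (n c : ℕ) (G : SimpleGraph (Fin n)) (pos : Fin n → Fin d → ℝ) (w : ℝ)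
      (S : Fin n → Finset (Fin n)) (F : ℝ → ℝ),
      (∀ p : Fin d → ℝ, {v | ∀ k, p k ≤ pos v k ∧ pos v k ≤ p k + 1}.ncard ≤ ρ) →
      (∀ u v, G.Adj u v → ∀ k, |pos u k - pos v k| ≤ W) → w ≤ W → 1 ≤ c →
      (∀ j, ∀ i ∈ S j, FillReachable G (c + 1) j i) →
      IsSidePotential θ c ((d - 1) * e) η F →
      ∀ (lo hi : Fin d → ℝ) (l : List (Fin n)), NestedDissection G pos w θ lo hi l →
      OuterNear G pos W lo hi l → l.Pairwise (· < ·) → WellShaped θ lo hi →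
      (l.map fun j => ((S j).card : ℝ) ^ e).sum
        ≤ K * (l.length + boxPotential F fun k => hi k - lo k) := by
  obtain ⟨K, hK0, hK⟩ := separator_cost_le d ρ e hθ hθ' hW1
  -- `K` per vertex pays for small boxes; `K / η` times a drop of `η` times the cost term pays for
  -- large ones.
  refine ⟨K + K / η, by positivity, ?_⟩
  intro n c G pos w S F hρ hW hw hc hS hF lo hi l h
  induction h with
  | nil lo hi =>
    intro _ _ shape
    have h1 : 0 ≤ ∏ k, (hi k - lo k) := Finset.prod_nonneg fun k _ => (shape k).1.le
    have h2 : 0 ≤ ∑ k, F (hi k - lo k) := Finset.sum_nonneg fun k _ => hF.nonneg _ (shape k).1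
    simp only [List.map_nil, List.sum_nil, List.length_nil, Nat.cast_zero, zero_add, boxPotential]
    positivity
  | node lo hi a t V₁ V₂ Vsep long balanced separated slice left right ihl ihr =>
    intro outer sorted shape
    have hpos : ∀ k, 0 < hi k - lo k := fun k => (shape k).1
    obtain ⟨ht1, ht2⟩ := cut_pos hpos hθ balanced
    have hbox := (NestedDissection.node lo hi a t V₁ V₂ Vsep long balanced separated slice left
      right).mem_box hθ hpos
    have slice' : ∀ v ∈ Vsep, (∀ k, lo k ≤ pos v k ∧ pos v k ≤ hi k) ∧ |pos v a - t| ≤ W :=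
      fun v hv => ⟨(slice v hv).1, (slice v hv).2.trans hw⟩
    have shapeL : WellShaped θ lo (Function.update hi a t) := by
      refine shape.of_cut hθ long (fun k hk => by simp [hk]) ?_ ?_ <;>
        simp only [Function.update_self] <;> linarith [balanced.1]
    have shapeR : WellShaped θ (Function.update lo a t) hi := by
      refine shape.of_cut hθ long (fun k hk => by simp [hk]) ?_ ?_ <;>
        simp only [Function.update_self] <;> linarith [balanced.2]
    have sorted₁ := List.pairwise_append.1 (List.pairwise_append.1 sorted).1
    have boundL := ihl
      (outer.left sorted hW ht2 separated (fun v hv => (slice' v hv).2) fun v hv => by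
        simpa using (left.mem_box hθ (fun k => (shapeL k).1) v hv a).2) sorted₁.1 shapeL
    have boundR := ihr
      (outer.right sorted hW ht1 separated (fun v hv => (slice' v hv).2) fun v hv => by
        simpa using (right.mem_box hθ (fun k => (shapeR k).1) v hv a).1) sorted₁.2.1 shapeR
    have eL : (fun k => Function.update hi a t k - lo k)
        = Function.update (fun k => hi k - lo k) a (t - lo a) := by
      ext k
      rcases eq_or_ne k a with rfl | hk <;> simp [*]
    have eR : (fun k => hi k - Function.update lo a t k)
        = Function.update (fun k => hi k - lo k) a (hi a - t) := by
      ext k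
      rcases eq_or_ne k a with rfl | hk <;> simp [*]
    rw [eL] at boundL
    rw [eR] at boundR
    have hcost := hK n c G pos lo hi a t V₁ V₂ Vsep S hρ hW hc hS outer sorted slice' hbox shape
      long
    have hvol : 0 < ∏ k, (hi k - lo k) := Finset.prod_pos fun k _ => hpos k
    have hKη : 0 ≤ K / η := by positivity
    simp only [List.map_append, List.sum_append, List.length_append, Nat.cast_add]
    set σ : Fin d → ℝ := fun k => hi k - lo k with hσ
    rcases hcost with ⟨-, hcost⟩ | ⟨hlarge, hcost⟩
    -- In a small box the potential merely must not increase, hence `y = 0`.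
    · have hcut := boxPotential_cut (F := F) (σ := σ) (a := a) (x := t - lo a) (x' := hi a - t)
        (y := 0) hpos (by linarith) (by linarith) (by simp [hσ])
        (by simpa using hF.mono (σ a) (t - lo a) (by linarith) (by simp only [hσ]; linarith))
        (by simpa using hF.mono (σ a) (hi a - t) (by linarith) (by simp only [hσ]; linarith))
      have h1 : 0 ≤ K / η * (Vsep.length : ℝ) := by positivity
      have h2 := mul_le_mul_of_nonneg_left hcut (add_nonneg hK0 hKη)
      linarith
    -- Balance leaves each part at most the fraction `1 - θ` of the side, so `F` drops on both.
    · have hcut := boxPotential_cut (F := F) (σ := σ) (a := a) (x := t - lo a) (x' := hi a - t)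
        hpos (by linarith) (by linarith) (by simp [hσ])
        (hF.drop (σ a) (t - lo a) hlarge (by linarith) (by simp only [hσ]; linarith [balanced.2]))
        (hF.drop (σ a) (hi a - t) hlarge (by linarith) (by simp only [hσ]; linarith [balanced.1]))
      have h1 : 0 ≤ (K + K / η) * (Vsep.length : ℝ) := by positivity
      have h2 := mul_le_mul_of_nonneg_left hcut (add_nonneg hK0 hKη)
      have hx : 0 ≤ (∏ k, σ k) * (min (σ a) c ^ ((d - 1) * e) / σ a) := by
        have := hpos a
        have : (0 : ℝ) ≤ min (σ a) c := le_min this.le (Nat.cast_nonneg c)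
        have : 0 ≤ σ a := (hpos a).le
        positivity
      have h3 : K * ((∏ k, σ k) * (min (σ a) c ^ ((d - 1) * e) / σ a)) ≤
          (K + K / η) * ((∏ k, σ k) * (η * (min (σ a) c ^ ((d - 1) * e) / σ a))) := by
        have e1 : (K + K / η) * ((∏ k, σ k) * (η * (min (σ a) c ^ ((d - 1) * e) / σ a)))
          = (K * η + K) * ((∏ k, σ k) * (min (σ a) c ^ ((d - 1) * e) / σ a)) := by
          field_simp
        rw [e1]
        have := mul_nonneg hK0 hη.le
        gcongr
        linarith
      have hcost' := hcost.trans h3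
      linarith

end Summation

/-! ### Time and memory of the programs -/

section Cost

variable {n : ℕ} {α β : Type}

/-- The program `p` takes time at most `T` and allocates only cells from `S`. -/
def CostsAtMost (S : Finset (Cell n)) (p : Prog n α) (T : ℕ) : Prop :=
  ∀ M : Machine n, (p.run M).2.time ≤ M.time + T ∧ (p.run M).2.used ⊆ M.used ∪ S

variable {S : Finset (Cell n)}

theorem CostsAtMost.bind {p : Prog n α} {q : α → Prog n β} {T T' : ℕ} (hp : CostsAtMost S p T)
    (hq : ∀ a, CostsAtMost S (q a) T') : CostsAtMost S (p >>= q) (T + T') := by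
  intro M
  obtain ⟨h1, h2⟩ := hp M
  obtain ⟨h3, h4⟩ := hq (p.run M).1 (p.run M).2
  refine ⟨?_, ?_⟩
  · calc ((p >>= q).run M).2.time = ((q (p.run M).1).run (p.run M).2).2.time := rfl
      _ ≤ _ := by omega
  · calc ((p >>= q).run M).2.used = ((q (p.run M).1).run (p.run M).2).2.used := rfl
      _ ⊆ _ := h4
      _ ⊆ (M.used ∪ S) ∪ S := Finset.union_subset_union_left h2
      _ = _ := by rw [Finset.union_assoc, Finset.union_self]

theorem CostsAtMost.mono {p : Prog n α} {T T' : ℕ} (hp : CostsAtMost S p T) (h : T ≤ T') :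
    CostsAtMost S p T' :=
  fun M => ⟨(hp M).1.trans (by omega), (hp M).2⟩

theorem costsAtMost_load (x : Cell n) : CostsAtMost S (load x) 1 :=
  fun _ => ⟨le_rfl, Finset.subset_union_left⟩

theorem costsAtMost_flop (v : ℂ) : CostsAtMost S (flop v) 1 :=
  fun _ => ⟨le_rfl, Finset.subset_union_left⟩

theorem costsAtMost_store {x : Cell n} (v : ℂ) (hx : x ∈ S) : CostsAtMost S (store x v) 1 :=
  fun M => ⟨le_rfl, show insert x M.used ⊆ _ from
    Finset.insert_subset (Finset.mem_union_right _ hx) Finset.subset_union_left⟩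

theorem costsAtMost_forM (l : List (Fin n)) (f : Fin n → Prog n PUnit) (T : Fin n → ℕ)
    (h : ∀ i ∈ l, CostsAtMost S (f i) (T i)) : CostsAtMost S (l.forM f) (l.map T).sum := by
  induction l with
  | nil => exact fun M => ⟨le_rfl, Finset.subset_union_left⟩
  | cons i l ih =>
    rw [List.map_cons, List.sum_cons]
    exact (h i (by simp)).bind fun _ => ih fun j hj => h j (by simp [hj])

theorem costsAtMost_forM_const (l : List (Fin n)) (f : Fin n → Prog n PUnit) (T : ℕ)
    (h : ∀ i ∈ l, CostsAtMost S (f i) T) : CostsAtMost S (l.forM f) (l.length * T) := by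
  simpa using costsAtMost_forM l f (fun _ => T) h

/-! ### Operation and cell counts of the two algorithms in terms of column lengths -/

variable (P : Fin n → Fin n → Prop)

/-- The cells written by the two algorithms. -/
noncomputable def workCells : Finset (Cell n) :=
  Finset.univ.image Cell.D ∪ Finset.univ.image Cell.W ∪ (Finset.univ.image fun j => Cell.B j j) ∪
    Finset.univ.biUnion fun j => ((colIdx P j).toFinset.image fun i => Cell.L i j) ∪
      ((colIdx P j).toFinset.image fun i => Cell.B i j) ∪
      ((colIdx P j).toFinset.image fun i => Cell.B j i)

theorem card_workCells_le :
    (workCells P).card ≤ 3 * n + 3 * ∑ j, (colIdx P j).length := by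
  have h1 : ∀ f : Fin n → Cell n, (Finset.univ.image f).card ≤ n := fun f => by
    simpa using Finset.card_image_le (s := (Finset.univ : Finset (Fin n))) (f := f)
  have h2 : ∀ j (f : Fin n → Cell n), ((colIdx P j).toFinset.image f).card ≤ (colIdx P j).length :=
    fun j f => Finset.card_image_le.trans (List.toFinset_card_le _)
  have h3 := Finset.card_biUnion_le (s := (Finset.univ : Finset (Fin n)))
    (t := fun j => ((colIdx P j).toFinset.image fun i => Cell.L i j) ∪
      ((colIdx P j).toFinset.image fun i => Cell.B i j) ∪
      ((colIdx P j).toFinset.image fun i => Cell.B j i))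
  have h4 : ∀ j ∈ (Finset.univ : Finset (Fin n)),
      (((colIdx P j).toFinset.image fun i => Cell.L i j) ∪
      ((colIdx P j).toFinset.image fun i => Cell.B i j) ∪
      ((colIdx P j).toFinset.image fun i => Cell.B j i)).card ≤ 3 * (colIdx P j).length := by
    intro j _
    refine (Finset.card_union_le _ _).trans ?_
    have := Finset.card_union_le ((colIdx P j).toFinset.image fun i => Cell.L i j)
      ((colIdx P j).toFinset.image fun i => Cell.B i j)
    have := h2 j fun i => Cell.L i j
    have := h2 j fun i => Cell.B i j
    have := h2 j fun i => Cell.B j i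
    omega
  have h5 := h3.trans (Finset.sum_le_sum h4)
  rw [← Finset.mul_sum] at h5
  refine (Finset.card_union_le _ _).trans (le_trans (add_le_add ?_ h5) le_rfl)
  refine (Finset.card_union_le _ _).trans ?_
  have := Finset.card_union_le ((Finset.univ : Finset (Fin n)).image Cell.D)
    (Finset.univ.image Cell.W)
  have := h1 Cell.D
  have := h1 Cell.W
  have := h1 fun j => Cell.B j j
  omega

variable {P}

theorem D_mem_workCells (j : Fin n) : Cell.D j ∈ workCells P := by simp [workCells]

theorem W_mem_workCells (j : Fin n) : Cell.W j ∈ workCells P := by simp [workCells]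

theorem B_diag_mem_workCells (j : Fin n) : Cell.B j j ∈ workCells P := by simp [workCells]

theorem L_mem_workCells {i j : Fin n} (h : i ∈ colIdx P j) : Cell.L i j ∈ workCells P := by
  refine Finset.mem_union_right _ (Finset.mem_biUnion.2 ⟨j, Finset.mem_univ _, ?_⟩)
  simp [h]

theorem B_lower_mem_workCells {i j : Fin n} (h : i ∈ colIdx P j) : Cell.B i j ∈ workCells P := by
  refine Finset.mem_union_right _ (Finset.mem_biUnion.2 ⟨j, Finset.mem_univ _, ?_⟩)
  simp [h]

theorem B_upper_mem_workCells {i j : Fin n} (h : i ∈ colIdx P j) : Cell.B j i ∈ workCells P := by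
  refine Finset.mem_union_right _ (Finset.mem_biUnion.2 ⟨j, Finset.mem_univ _, ?_⟩)
  simp [h]

theorem costsAtMost_factorColumn (j : Fin n) :
    CostsAtMost (workCells P) (factorColumn P j)
      (4 + 5 * (colIdx P j).length +
        ((rowIdx P j).map fun k => 3 + 5 * (colIdx P k).length).sum) := by
  have hW : ∀ i v, CostsAtMost (workCells P) (store (Cell.W i) v) 1 :=
    fun i v => costsAtMost_store v (W_mem_workCells i)
  have init : CostsAtMost (workCells P) ((colIdx P j).forM fun i => do
      let a ← load (Cell.A i j)
      store (Cell.W i) a) ((colIdx P j).length * 2) :=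
    costsAtMost_forM_const _ _ 2 fun i _ => (costsAtMost_load _).bind fun a => hW i a
  have inner : ∀ k m, CostsAtMost (workCells P) ((colIdx P k).forM fun i => do
      let x ← load (Cell.L i k)
      let y ← flop (x * m)
      let s ← load (Cell.W i)
      let s' ← flop (s - y)
      store (Cell.W i) s') ((colIdx P k).length * 5) := fun k m =>
    costsAtMost_forM_const _ _ 5 fun i _ => (costsAtMost_load _).bind fun _ =>
      (costsAtMost_flop _).bind fun _ => (costsAtMost_load _).bind fun _ =>
      (costsAtMost_flop _).bind fun s' => hW i s'
  have update : CostsAtMost (workCells P) ((rowIdx P j).forM fun k => do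
      let l ← load (Cell.L j k)
      let d ← load (Cell.D k)
      let m ← flop (d * l)
      (colIdx P k).forM fun i => do
        let x ← load (Cell.L i k)
        let y ← flop (x * m)
        let s ← load (Cell.W i)
        let s' ← flop (s - y)
        store (Cell.W i) s') ((rowIdx P j).map fun k => 3 + 5 * (colIdx P k).length).sum :=
    costsAtMost_forM _ _ _ fun k _ =>
      CostsAtMost.mono ((costsAtMost_load _).bind fun _ => (costsAtMost_load _).bind fun _ =>
        (costsAtMost_flop _).bind fun m => inner k m) (by omega)
  have finish : ∀ d : ℂ, CostsAtMost (workCells P) ((colIdx P j).forM fun i => do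
      let s ← load (Cell.W i)
      let q ← flop (s / d)
      store (Cell.L i j) q) ((colIdx P j).length * 3) := fun d =>
    costsAtMost_forM_const _ _ 3 fun i hi => (costsAtMost_load _).bind fun _ =>
      (costsAtMost_flop _).bind fun _ => costsAtMost_store _ (L_mem_workCells hi)
  exact CostsAtMost.mono ((costsAtMost_load _).bind fun _ => (hW _ _).bind fun _ =>
    init.bind fun _ => update.bind fun _ => (costsAtMost_load _).bind fun d =>
    (costsAtMost_store _ (D_mem_workCells _)).bind fun _ => finish d) (by omega)

theorem costsAtMost_invertColumn (j : Fin n) :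
    CostsAtMost (workCells P) (invertColumn P j)
      (3 + 9 * (colIdx P j).length + 6 * (colIdx P j).length ^ 2) := by
  unfold invertColumn
  refine CostsAtMost.mono
    ((costsAtMost_forM_const _ _ (1 + 6 * (colIdx P j).length) fun i hi =>
      CostsAtMost.mono ((costsAtMost_store _ (B_lower_mem_workCells hi)).bind fun _ =>
        costsAtMost_forM_const _ _ 6 fun k _ => (costsAtMost_load _).bind fun _ =>
          (costsAtMost_load _).bind fun _ => (costsAtMost_flop _).bind fun _ =>
          (costsAtMost_load _).bind fun _ => (costsAtMost_flop _).bind fun _ =>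
          costsAtMost_store _ (B_lower_mem_workCells hi)) (by omega)).bind fun _ =>
    (costsAtMost_forM_const _ _ 2 fun i hi => (costsAtMost_load _).bind fun _ =>
      costsAtMost_store _ (B_upper_mem_workCells hi)).bind fun _ =>
    (costsAtMost_load _).bind fun _ => (costsAtMost_flop _).bind fun _ =>
    (costsAtMost_store _ (B_diag_mem_workCells j)).bind fun _ =>
    costsAtMost_forM_const _ _ 6 fun i _ => (costsAtMost_load _).bind fun _ =>
      (costsAtMost_load _).bind fun _ => (costsAtMost_flop _).bind fun _ =>
      (costsAtMost_load _).bind fun _ => (costsAtMost_flop _).bind fun _ =>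
      costsAtMost_store _ (B_diag_mem_workCells j)) (le_of_eq (by ring))

theorem sum_map_filter_finRange (p : Fin n → Prop) [DecidablePred p] (f : Fin n → ℕ) :
    (((List.finRange n).filter fun i => p i).map f).sum = ∑ i, if p i then f i else 0 := by
  rw [← List.sum_toFinset _ ((List.nodup_finRange n).filter _), List.toFinset_filter,
    List.toFinset_finRange, Finset.sum_filter]
  simp

/-- Double counting of the stored entries `(j, k)` with `k < j`, by rows and by columns. Since the
factorization traverses column `k` once per entry of that column, its cost becomes a sum of squared
column lengths. -/
theorem sum_rowIdx (f : Fin n → ℕ) :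
    ∑ j, ((rowIdx P j).map f).sum = ∑ k, (colIdx P k).length * f k := by
  classical
  have h : ∀ k, (colIdx P k).length * f k = ((colIdx P k).map fun _ => f k).sum := fun k => by
    simp
  simp_rw [h, rowIdx, colIdx, sum_map_filter_finRange]
  exact Finset.sum_comm

theorem sum_length_rowIdx : ∑ j, (rowIdx P j).length = ∑ k, (colIdx P k).length := by
  simpa using sum_rowIdx (P := P) fun _ => 1

theorem sum_map_finRange (f : Fin n → ℕ) : ((List.finRange n).map f).sum = ∑ i, f i := by
  rw [← List.sum_toFinset _ (List.nodup_finRange n), List.toFinset_finRange]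

theorem costsAtMost_algorithms :
    CostsAtMost (workCells P)
      (incompleteFactorization P >>= fun _ => incompleteSelectedInversion P)
      (7 * n + 28 * ∑ j, (colIdx P j).length ^ 2) := by
  refine CostsAtMost.mono ((costsAtMost_forM _ _ _ fun j _ => costsAtMost_factorColumn j).bind
    fun _ => costsAtMost_forM _ _ _ fun j _ => costsAtMost_invertColumn j) ?_
  rw [List.map_reverse, List.sum_reverse, sum_map_finRange, sum_map_finRange]
  simp only [Finset.sum_add_distrib, sum_rowIdx, ← Finset.mul_sum, Finset.sum_const,
    Finset.card_univ, Fintype.card_fin, smul_eq_mul]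
  -- The linear terms 5 + 3 + 9 are absorbed into the quadratic ones 5 + 6, which gives 28.
  have h1 : ∑ j, (colIdx P j).length ≤ ∑ j, (colIdx P j).length ^ 2 :=
    Finset.sum_le_sum fun j _ => Nat.le_self_pow two_ne_zero _
  have h2 : ∑ k, (colIdx P k).length * (3 + 5 * (colIdx P k).length)
      = 3 * ∑ j, (colIdx P j).length + 5 * ∑ j, (colIdx P j).length ^ 2 := by
    rw [Finset.mul_sum, Finset.mul_sum, ← Finset.sum_add_distrib]
    exact Finset.sum_congr rfl fun k _ => by ring
  omega

theorem runtime_le (A : Matrix (Fin n) (Fin n) ℂ) :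
    runtime P A ≤ 7 * n + 28 * ∑ j, (colIdx P j).length ^ 2 := by
  have := (costsAtMost_algorithms (P := P) (initialMachine A)).1
  exact this.trans_eq (zero_add _)

theorem memory_le (A : Matrix (Fin n) (Fin n) ℂ) :
    memory P A ≤ (initialMachine A).used.card + 5 * n + 5 * ∑ j, (colIdx P j).length := by
  have h1 := Finset.card_le_card (costsAtMost_algorithms (P := P) (initialMachine A)).2
  have h2 := Finset.card_union_le (initialMachine A).used (workCells P)
  have h3 := card_workCells_le P
  have h4 : ∑ j, ((colIdx P j).length + (rowIdx P j).length + 2)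
      = 2 * ∑ j, (colIdx P j).length + 2 * n := by
    simp only [Finset.sum_add_distrib, sum_length_rowIdx, Finset.sum_const, Finset.card_univ,
      Fintype.card_fin, smul_eq_mul]
    ring
  have h5 : memory P A = ((incompleteFactorization P >>= fun _ =>
    incompleteSelectedInversion P).run (initialMachine A)).2.used.card +
      ∑ j, ((colIdx P j).length + (rowIdx P j).length + 2) := rfl
  omega

end Cost

/-! ### Incomplete factorization and incomplete selected inversion -/

section Main

theorem fillReachable_of_ifnz {n c : ℕ} {H L : Matrix (Fin n) (Fin n) ℂ} {i j : Fin n} (hij : j < i)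
    (h : IFNZ H L c i j) : FillReachable (matrixGraph H) (c + 1) j i := by
  have h1 : fillDist (matrixGraph H) i j ≤ ((c + 1 : ℕ) : ℕ∞) := by
    simpa using tsub_le_iff_right.1 h.2
  -- The infimum is attained: otherwise all fill paths would have length at least `c + 2`.
  obtain ⟨p, hp, hlen⟩ : ∃ p : (matrixGraph H).Walk i j, IsFillPath p ∧ p.length ≤ c + 1 := by
    by_contra! hcon
    have h2 : ((c + 1 + 1 : ℕ) : ℕ∞) ≤ fillDist (matrixGraph H) i j :=
      le_iInf₂ fun p hp => by exact_mod_cast hcon p hp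
    have h3 := h2.trans h1
    norm_cast at h3
    omega
  refine ⟨hij, p.reverse, fun k hk => ?_, by simpa using hlen⟩
  rw [SimpleGraph.Walk.support_reverse, List.mem_reverse] at hk
  rcases hp.2 k hk with h2 | h2 | h2
  · exact Or.inl h2
  · exact Or.inr h2.le
  · exact Or.inr (h2.le.trans (min_le_right _ _))

/-- A nonzero of `H - z • 1` is diagonal or an edge, so for each row its column index lies in a cube
of side `2 * W` around the row's position. -/
theorem card_initialMachine_used_le {n d ρ : ℕ} {R κ W : ℝ} {H : Matrix (Fin n) (Fin n) ℂ} (z : ℂ)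
    {pos : Fin n → Fin d → ℝ} {lo hi : Fin d → ℝ}
    (h : HasEffectiveDimension d (matrixGraph H) ρ R κ pos lo hi) (hW : R ≤ W) (hW0 : 0 ≤ W) :
    ((initialMachine (H - z • 1)).used.card : ℝ) ≤ n * (ρ * (2 * W + 1) ^ d) := by
  classical
  have h1 : (initialMachine (H - z • 1)).used.card ≤
      ∑ i, (Finset.univ.filter fun j => ∀ k, |pos j k - pos i k| ≤ W).card := by
    refine Finset.card_image_le.trans ?_
    rw [← Finset.card_sigma]
    refine Finset.card_le_card_of_injOn (fun x => ⟨x.1, x.2⟩) ?_ ?_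
    · intro x hx
      have hx : (H - z • (1 : Matrix (Fin n) (Fin n) ℂ)) x.1 x.2 ≠ 0 :=
        (Finset.mem_filter.1 (Finset.mem_coe.1 hx)).2
      simp only [Finset.coe_sigma, Set.mem_sigma_iff, Finset.coe_univ, Set.mem_univ, true_and,
        Finset.coe_filter, Finset.mem_univ, Set.mem_ofPred_eq]
      intro k
      by_cases hne : x.1 = x.2
      · simpa [hne] using hW0
      · have hadj : (matrixGraph H).Adj x.2 x.1 := by
          rw [matrixGraph, SimpleGraph.fromRel_adj]
          refine ⟨Ne.symm hne, Or.inr ?_⟩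
          simpa [Matrix.one_apply_ne hne] using hx
        exact (h.range_le _ _ hadj k).trans hW
    · rintro ⟨a, b⟩ _ ⟨a', b'⟩ _ hab
      simpa using hab
  have h2 : ∀ i, ((Finset.univ.filter fun j => ∀ k, |pos j k - pos i k| ≤ W).card : ℝ)
      ≤ ρ * (2 * W + 1) ^ d := fun i => by
    have := card_le_of_mem_box h.density_le
      (Finset.univ.filter fun j => ∀ k, |pos j k - pos i k| ≤ W) (fun k => pos i k - W)
      (fun _ => 2 * W) (fun _ => by positivity) fun v hv k => by
        have := abs_le.1 ((Finset.mem_filter.1 hv).2 k)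
        constructor <;> linarith
    simpa using this
  calc ((initialMachine (H - z • 1)).used.card : ℝ)
      ≤ ∑ i, ((Finset.univ.filter fun j => ∀ k, |pos j k - pos i k| ≤ W).card : ℝ) := by
        exact_mod_cast h1
    _ ≤ ∑ _i : Fin n, ρ * (2 * W + 1) ^ d := Finset.sum_le_sum fun i _ => h2 i
    _ = _ := by simp

/-- At the root no vertex lies outside the cluster, so `OuterNear` is vacuous, and sides of length
at least 1 give `WellShaped`. The density bound turns the volume in the root potential into `n / κ`.
-/
theorem sum_length_colIdx_pow_le (d ρ e : ℕ) {R κ w θ η : ℝ} (hκ : 0 < κ) (hθ : 0 < θ)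
    (hθ' : θ ≤ 1) (hη : 0 < η) :
    ∃ K : ℝ, 0 ≤ K ∧ ∀ (n c : ℕ) (H L : Matrix (Fin n) (Fin n) ℂ)
      (pos : Fin n → Fin d → ℝ) (lo hi : Fin d → ℝ) (F : ℝ → ℝ) (Fm : ℝ), 1 ≤ c →
      HasEffectiveDimension d (matrixGraph H) ρ R κ pos lo hi →
      NestedDissection (matrixGraph H) pos w θ lo hi (List.finRange n) →
      IsSidePotential θ c ((d - 1) * e) η F → (∀ s, 0 < s → F s ≤ Fm) →
      ((∑ j, (colIdx (IFNZ H L c) j).length ^ e : ℕ) : ℝ) ≤ K * (n * (1 + Fm)) := by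
  -- One length `W` serves both as the range of edges and as the half-width of separators.
  obtain ⟨K, hK0, hK⟩ := NestedDissection.sum_card_pow_le d ρ e hθ hθ'
    (W := max 1 (max R w)) (le_max_left _ _) hη
  refine ⟨K * (1 + d / κ), by positivity, ?_⟩
  intro n c H L pos lo hi F Fm hc hdim hnd hF hFm
  have hFm0 : 0 ≤ Fm := (hF.nonneg 1 one_pos).trans (hFm 1 one_pos)
  have hside : ∀ k, 0 < hi k - lo k := fun k => one_pos.trans_le (hdim.one_le_side k)
  have hmem : ∀ j i, i ∈ (colIdx (IFNZ H L c) j).toFinset ↔ j < i ∧ IFNZ H L c i j := fun j i => by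
    simp [colIdx]
  have hcard : ∀ j, (colIdx (IFNZ H L c) j).toFinset.card = (colIdx (IFNZ H L c) j).length :=
    fun j => List.toFinset_card_of_nodup ((List.nodup_finRange n).filter _)
  have h1 := hK n c (matrixGraph H) pos w (fun j => (colIdx (IFNZ H L c) j).toFinset) F
    hdim.density_le
    (fun u v huv k => (hdim.range_le u v huv k).trans
      ((le_max_left _ _).trans (le_max_right _ _)))
    ((le_max_right _ _).trans (le_max_right _ _)) hc
    (fun j i hi => fillReachable_of_ifnz ((hmem j i).1 hi).1 ((hmem j i).1 hi).2)
    hF lo hi _ hnd (fun u hu => absurd (List.mem_finRange u) hu) (List.pairwise_lt_finRange n)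
    fun k => ⟨hside k, fun k' => (min_le_left _ _).trans (hdim.one_le_side k)⟩
  have h2 : ((List.finRange n).map fun j =>
      (((colIdx (IFNZ H L c) j).toFinset.card : ℕ) : ℝ) ^ e).sum
      = ((∑ j, (colIdx (IFNZ H L c) j).length ^ e : ℕ) : ℝ) := by
    rw [← List.sum_toFinset _ (List.nodup_finRange n), List.toFinset_finRange]
    push_cast
    simp only [hcard]
  rw [h2, List.length_finRange] at h1
  refine h1.trans ?_
  have hvol : ∏ k, (hi k - lo k) ≤ n / κ := by
    rw [le_div_iff₀ hκ, mul_comm]; exact hdim.le_density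
  have hpot : boxPotential F (fun k => hi k - lo k) ≤ n / κ * (d * Fm) := by
    have hsum : ∑ k, F (hi k - lo k) ≤ d * Fm := by
      simpa using Finset.sum_le_sum fun k (_ : k ∈ (Finset.univ : Finset (Fin d))) =>
        hFm (hi k - lo k) (hside k)
    exact mul_le_mul hvol hsum (Finset.sum_nonneg fun k _ => hF.nonneg _ (hside k))
      (by positivity)
  rw [mul_assoc]
  gcongr
  have e1 : (1 + d / κ) * (n * (1 + Fm)) = n + n / κ * (d * Fm) + (n * Fm + n * (d / κ)) := by ring
  rw [e1]
  have : 0 ≤ n * Fm + n * (d / κ) := by positivity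
  linarith

theorem runtime_le_of_effectiveDimension (d ρ p : ℕ) {R κ w θ : ℝ} (hκ : 0 < κ) (hθ : 0 < θ) (hθ' : θ ≤ 1)
    (hp : (d - 1) * 2 = p + 2) :
    ∃ C : ℝ, 0 ≤ C ∧ ∀ (n c : ℕ) (H L : Matrix (Fin n) (Fin n) ℂ) (z : ℂ)
      (pos : Fin n → Fin d → ℝ) (lo hi : Fin d → ℝ), 1 ≤ c →
      HasEffectiveDimension d (matrixGraph H) ρ R κ pos lo hi →
      NestedDissection (matrixGraph H) pos w θ lo hi (List.finRange n) →
      (runtime (IFNZ H L c) (H - z • 1) : ℝ) ≤ C * (n * (c : ℝ) ^ (p + 1)) := by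
  obtain ⟨K, hK0, hK⟩ := sum_length_colIdx_pow_le d ρ 2 (R := R) (w := w) hκ hθ hθ' hθ
  refine ⟨7 + 28 * (K * 3), by positivity, ?_⟩
  intro n c H L z pos lo hi hc hdim hnd
  have hc' : (1 : ℝ) ≤ c := by exact_mod_cast hc
  have hc0 : (0 : ℝ) < c := by linarith
  have h1 := hK n c H L pos lo hi _ (2 * (c : ℝ) ^ (p + 1)) hc hdim hnd
    (hp ▸ isSidePotential_pow p hc0 hθ) (fun s hs => powPotential_le_bound p hc0 hs)
  have h2 : (runtime (IFNZ H L c) (H - z • 1) : ℝ) ≤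
      7 * n + 28 * ((∑ j, (colIdx (IFNZ H L c) j).length ^ 2 : ℕ) : ℝ) := by
    exact_mod_cast runtime_le (P := IFNZ H L c) (H - z • 1)
  have h3 : (1 : ℝ) ≤ (c : ℝ) ^ (p + 1) := one_le_pow₀ hc'
  have h4 : (n : ℝ) ≤ n * (c : ℝ) ^ (p + 1) := le_mul_of_one_le_right (by positivity) h3
  have h5 : K * (n * (1 + 2 * (c : ℝ) ^ (p + 1))) ≤ K * 3 * (n * (c : ℝ) ^ (p + 1)) := by
    have := mul_le_mul_of_nonneg_left h4 hK0
    linarith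
  linarith

/-- The potential stays open, as the exponent `d - 1` requires the logarithmic one for `d = 2` and a
power for `d = 3`. -/
theorem memory_le_of_sidePotential (d ρ : ℕ) {R κ w θ η : ℝ} (hκ : 0 < κ) (hθ : 0 < θ)
    (hθ' : θ ≤ 1) (hη : 0 < η) :
    ∃ C : ℝ, 0 ≤ C ∧ ∀ (n c : ℕ) (H L : Matrix (Fin n) (Fin n) ℂ) (z : ℂ)
      (pos : Fin n → Fin d → ℝ) (lo hi : Fin d → ℝ) (F : ℝ → ℝ) (Fm : ℝ), 1 ≤ c →
      HasEffectiveDimension d (matrixGraph H) ρ R κ pos lo hi →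
      NestedDissection (matrixGraph H) pos w θ lo hi (List.finRange n) →
      IsSidePotential θ c (d - 1) η F → (∀ s, 0 < s → F s ≤ Fm) →
      (memory (IFNZ H L c) (H - z • 1) : ℝ) ≤ C * (n * (1 + Fm)) := by
  obtain ⟨K, hK0, hK⟩ := sum_length_colIdx_pow_le d ρ 1 (R := R) (w := w) hκ hθ hθ' hη
  set W := max 0 R with hW
  have hW0 : 0 ≤ W := le_max_left _ _
  refine ⟨ρ * (2 * W + 1) ^ d + 5 + 5 * K, by positivity, ?_⟩
  intro n c H L z pos lo hi F Fm hc hdim hnd hF hFm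
  have hFm0 : 0 ≤ Fm := (hF.nonneg 1 one_pos).trans (hFm 1 one_pos)
  have h1 := hK n c H L pos lo hi F Fm hc hdim hnd (by simpa using hF) hFm
  have h2 : (memory (IFNZ H L c) (H - z • 1) : ℝ) ≤ (initialMachine (H - z • 1)).used.card +
      5 * n + 5 * ((∑ j, (colIdx (IFNZ H L c) j).length : ℕ) : ℝ) := by
    exact_mod_cast memory_le (P := IFNZ H L c) (H - z • 1)
  have h3 := card_initialMachine_used_le z hdim (le_max_right 0 R) hW0
  simp only [pow_one] at h1
  have h4 : 0 ≤ (ρ * (2 * W + 1) ^ d + 5) * (n * Fm) := by positivity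
  linarith

end Main

theorem mainTheorem4 (ρ : ℕ) (R κ w θ : ℝ) (hκ : 0 < κ) (hθ : 0 < θ) (hθ' : θ ≤ 1 / 2) :
    (∃ C : ℝ, ∀ (n c : ℕ) (H L : Matrix (Fin n) (Fin n) ℂ) (D : Fin n → ℂ) (z : ℂ)
        (pos : Fin n → Fin 2 → ℝ) (lo hi : Fin 2 → ℝ),
      1 ≤ c → H.IsSymm → LeadingMinorsInvertible (H - z • 1) → IsLDLT (H - z • 1) L D →
      HasEffectiveDimension 2 (matrixGraph H) ρ R κ pos lo hi →
      NestedDissection (matrixGraph H) pos w θ lo hi (List.finRange n) →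
        (runtime (IFNZ H L c) (H - z • 1) : ℝ) ≤ C * (n * c) ∧
        (2 ≤ c → (memory (IFNZ H L c) (H - z • 1) : ℝ) ≤ C * (n * Real.log c))) ∧
    (∃ C : ℝ, ∀ (n c : ℕ) (H L : Matrix (Fin n) (Fin n) ℂ) (D : Fin n → ℂ) (z : ℂ)
        (pos : Fin n → Fin 3 → ℝ) (lo hi : Fin 3 → ℝ),
      1 ≤ c → H.IsSymm → LeadingMinorsInvertible (H - z • 1) → IsLDLT (H - z • 1) L D →
      HasEffectiveDimension 3 (matrixGraph H) ρ R κ pos lo hi →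
      NestedDissection (matrixGraph H) pos w θ lo hi (List.finRange n) →
        (runtime (IFNZ H L c) (H - z • 1) : ℝ) ≤ C * (n * (c : ℝ) ^ 3) ∧
        (memory (IFNZ H L c) (H - z • 1) : ℝ) ≤ C * (n * c)) := by
  have hθ1 : θ ≤ 1 := by linarith
  refine ⟨?_, ?_⟩
  · obtain ⟨C, hC0, hC⟩ := runtime_le_of_effectiveDimension 2 ρ 0 (R := R) (w := w) hκ hθ hθ1 rfl
    obtain ⟨C', hC'0, hC'⟩ := memory_le_of_sidePotential 2 ρ (R := R) (w := w) hκ hθ hθ1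
      (η := θ ^ 2 / 2) (by positivity)
    have hlog2 : 0 < Real.log 2 := Real.log_pos one_lt_two
    -- The target is `log (1 + c) + 2 ≤ (2 + 2 / log 2) * log c`, from `1 + c ≤ c ^ 2` and `log 2 ≤
    -- log c`, both valid for `c ≥ 2`.
    refine ⟨max C (C' * (2 + 2 / Real.log 2)), ?_⟩
    intro n c H L D z pos lo hi hc _ _ _ hdim hnd
    have hc' : (1 : ℝ) ≤ c := by exact_mod_cast hc
    have hc0 : (0 : ℝ) < c := by linarith
    refine ⟨?_, fun hc2 => ?_⟩
    · have := hC n c H L z pos lo hi hc hdim hnd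
      rw [zero_add, pow_one] at this
      refine this.trans ?_
      gcongr
      exact le_max_left _ _
    · have hc2' : (2 : ℝ) ≤ c := by exact_mod_cast hc2
      have := hC' n c H L z pos lo hi _ _ hc hdim hnd (isSidePotential_log hc' hθ hθ')
        fun s hs => logPotential_le_bound hc0 hs
      refine this.trans ?_
      have hl : Real.log 2 ≤ Real.log c := Real.log_le_log two_pos hc2'
      have h1 : Real.log (1 + c) ≤ 2 * Real.log c := by
        rw [← Nat.cast_two, ← Real.log_pow]
        exact Real.log_le_log (by linarith) (by nlinarith)
      have h2 : 1 ≤ 1 / Real.log 2 * Real.log c := by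
        rw [one_div, inv_mul_eq_div, le_div_iff₀ hlog2]; linarith
      have h3 : 1 + (Real.log (1 + c) + 1) ≤ (2 + 2 / Real.log 2) * Real.log c := by
        have : 2 / Real.log 2 * Real.log c = 2 * (1 / Real.log 2 * Real.log c) := by ring
        linarith
      have hlc : 0 ≤ Real.log c := by linarith
      calc C' * (n * (1 + (Real.log (1 + c) + 1)))
          ≤ C' * (n * ((2 + 2 / Real.log 2) * Real.log c)) := by gcongr
        _ = C' * (2 + 2 / Real.log 2) * (n * Real.log c) := by ring
        _ ≤ _ := by gcongr; exact le_max_right _ _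
  -- Here `(3 - 1) * 2 = 2 + 2`, so `p = 2` and the runtime exponent is `p + 1 = 3`.
  · obtain ⟨C, hC0, hC⟩ := runtime_le_of_effectiveDimension 3 ρ 2 (R := R) (w := w) hκ hθ hθ1 rfl
    obtain ⟨C', hC'0, hC'⟩ := memory_le_of_sidePotential 3 ρ (R := R) (w := w) hκ hθ hθ1 hθ
    refine ⟨max C (C' * 3), ?_⟩
    intro n c H L D z pos lo hi hc _ _ _ hdim hnd
    have hc' : (1 : ℝ) ≤ c := by exact_mod_cast hc
    have hc0 : (0 : ℝ) < c := by linarith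
    refine ⟨?_, ?_⟩
    · refine (hC n c H L z pos lo hi hc hdim hnd).trans ?_
      gcongr
      exact le_max_left _ _
    · have := hC' n c H L z pos lo hi _ _ hc hdim hnd (isSidePotential_pow 0 hc0 hθ)
        fun s hs => powPotential_le_bound 0 hc0 hs
      refine this.trans ?_
      calc C' * (n * (1 + 2 * (c : ℝ) ^ (0 + 1))) ≤ C' * (n * (3 * c)) := by
            gcongr
            rw [zero_add, pow_one]
            linarith
        _ = C' * 3 * (n * c) := by ring
        _ ≤ _ := by gcongr; exact le_max_right _ _
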